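/- Let $\Gamma=\{a_1,a_2,a_3\}\subset\mathbb R^2$ be the vertices of an equilateral triangle of side $1$, let $\psi_i(x)=a_i+\tfrac12(x-a_i)$, and for $n\ge 0$ let $V^n$ be the union of the sets $\psi_{i_1}\circ\dots\circ\psi_{i_n}(\Gamma)$ over all words $i_1\dots i_n$ (so $V^0=\Gamma$). Points $x,y\in V^n$ are adjacent if the segment $[x,y]$ is the image of a side of the initial triangle under some $\psi_{i_1}\circ\dots\circ\psi_{i_n}$; these segments, of length $h_n=2^{-n}$, are the edges of level $n$. Let $S^n$ be the union of $V^n$ and all edges of level $n$, and let $S=\overline{\bigcup_n V^n}$ be the Sierpinski gasket. Let $d(x,y)$ be the infimum of the lengths of the continuous paths in $S$ from $x$ to $y$. For an interval $I$ and $\Omega\subset S$, let $\mathcal A(I,\Omega)$ be the set of curves $\xi:I\to\Omega$ which have at almost every $t\in I$ a metric derivative $|\xi'|(t)=\lim_{s\to t}d(\xi(s),\xi(t))/|s-t|$, with $|\xi'|\in L^1_{loc}(I)$, $|\xi'|\le 1$ a.e., and $d(\xi(s),\xi(t))\le\int_s^t|\xi'|(r)\,dr$ for $s\le t$ in $I$.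 Let $f:S\to\mathbb R$ be continuous with $\inf_S f>0$, and let $g:\Gamma\to\mathbb R$ satisfy the compatibility condition $$g(x)\le \inf\Big\{\int_0^T f(\xi(t))\,dt+g(y)\;:\; T>0,\ \xi\in\mathcal A([0,T],S),\ \xi(0)=x,\ \xi(T)=y\Big\}\qquad\text{for all }x,y\in\Gamma .$$ **Network solutions.** A solution of $|Du|=f$ on $S^n$ with $u=g$ on $\Gamma$ is a continuous $u:S^n\to\mathbb R$ with $u=g$ on $\Gamma$ which is both a subsolution and a supersolution in the following sense. (i) Let $x$ be an interior point of an edge $e$ and let $\phi\in C(S^n)$ be differentiable along $e$ at $x$, with derivative $p$ in the arc-length parameter. If $u-\phi$ has a local maximum at $x$, then $|p|\le f(x)$; if it has a local minimum at $x$, then $|p|\ge f(x)$. (ii) Let $x\in V^n\setminus\Gamma$. For distinct edges $e,e'$ incident to $x$, a function $\phi\in C(S^n)$ is an $(e,e')$-test function at $x$ if it has one-sided derivatives $p$ and $p'$ at $x$ from $x$ into $e$ and into $e'$, with $p+p'=0$. Subsolution: for all $e\ne e'$ incident to $x$ and every $(e,e')$-test function $\phi$ such that $u-\phi$ has a local maximum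 at $x$ relative to $e\cup e'$, $|p|\le f(x)$. Supersolution: for every $e$ incident to $x$ there is $e'\neq e$ incident to $x$ such that, for every $(e,e')$-test function $\phi$ such that $u-\phi$ has a local minimum at $x$ relative to $e\cup e'$, $|p|\ge f(x)$. **Metric viscosity solutions.** A metric viscosity solution of $|Du|=f$ in $S\setminus\Gamma$ with $u=g$ on $\Gamma$ is a function $u:S\to\mathbb R$ with $u=g$ on $\Gamma$ such that $u\circ\xi$ is continuous on $I$ for every interval $I$ and every $\xi\in\mathcal A(I,S)$, and such that for every $x\in S\setminus\Gamma$: (i) for every open interval $I\ni 0$ and every $\xi\in\mathcal A(I,S\setminus\Gamma)$ with $\xi(0)=x$, every $p$ in the superdifferential $D^+(u\circ\xi)(0)$ satisfies $|p|\le f(x)$; (ii) for every $\varepsilon>0$ there are $\xi\in\mathcal A(\mathbb R,S)$ with $\xi(0)=x$ and a lower semicontinuous $w:\mathbb R\to\mathbb R$ such that $T^+=\inf\{t\ge0:\xi(t)\in\Gamma\}$ and $T^-=\sup\{t\le0:\xi(t)\in\Gamma\}$ are finite, $w(0)=u(x)$, and for all $t\in(T^-,T^+)$ one has $w(t)\ge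 u(\xi(t))-\varepsilon$ and $|p|\ge f(\xi(t))-\varepsilon$ for all $p$ in the subdifferential $D^-w(t)$. **Theorem.** For every $n\ge0$ there is exactly one solution $u_n$ of $|Du|=f$ on $S^n$ with $u_n=g$ on $\Gamma$; there is exactly one metric viscosity solution $u$ of $|Du|=f$ in $S\setminus\Gamma$ with $u=g$ on $\Gamma$; $u$ is continuous on $S$; and $u_n\to u$ uniformly, that is, $$\lim_{n\to\infty}\ \sup_{x\in S^n}|u_n(x)-u(x)|=0 .$$ -/

import Mathlib

open Set Filter Topology MeasureTheory

noncomputable section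

namespace SierpinskiEikonal

/-- The Euclidean plane. -/
abbrev Plane : Type := EuclideanSpace ℝ (Fin 2)

/-! ### The gasket, its prefractal graphs and networks

Throughout, `a 0, a 1, a 2` are the vertices of the initial triangle. -/

/-- The contraction of ratio one half towards `p`. -/
def contraction (p x : Plane) : Plane := p + (1 / 2 : ℝ) • (x - p)

/-- The composition of contractions towards the vertices `a i` along a finite word. -/
def cellMap (a : Fin 3 → Plane) : List (Fin 3) → Plane → Plane
  | [] => id
  | i :: w => contraction (a i) ∘ cellMap a w

/-- The boundary: the three vertices of the initial triangle. -/
def corners (a : Fin 3 → Plane) : Set Plane := range a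

/-- The vertices of level `n`: images of the corners under all words of length `n`. -/
def vertices (a : Fin 3 → Plane) (n : ℕ) : Set Plane :=
  {x | ∃ w : List (Fin 3), w.length = n ∧ x ∈ cellMap a w '' corners a}

/-- Adjacency at level `n`: the segment from `x` to `y` is the image of a side of the
initial triangle under a word of length `n`. -/
def Adj (a : Fin 3 → Plane) (n : ℕ) (x y : Plane) : Prop :=
  ∃ w : List (Fin 3), w.length = n ∧
    ∃ i j : Fin 3, i ≠ j ∧ x = cellMap a w (a i) ∧ y = cellMap a w (a j)

/-- The prefractal network of level `n`: all vertices and edges of level `n`. -/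
def prefractal (a : Fin 3 → Plane) (n : ℕ) : Set Plane :=
  vertices a n ∪ {z | ∃ x y, Adj a n x y ∧ z ∈ segment ℝ x y}

/-- The Sierpinski gasket: the closure of the set of the vertices of all levels. -/
def gasket (a : Fin 3 → Plane) : Set Plane := closure (⋃ n, vertices a n)

/-! ### Viscosity solutions on the networks -/

/-- The common length of the edges of level `n`. -/
def edgeLength (n : ℕ) : ℝ := 1 / 2 ^ n

/-- The arc-length parametrization, over `[0, edgeLength n]`, of the edge of level `n`
from `x` to `y`. -/
def edgeParam (n : ℕ) (x y : Plane) (t : ℝ) : Plane :=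
  x + (t / edgeLength n) • (y - x)

/-- `p` is the derivative at `t` of `φ` along the edge from `x` to `y` (one-sided at an
endpoint). At `t = 0` this is the derivative from the vertex `x` into the edge, that is, the
product of the entry of the signed incidence matrix and of the derivative of `φ` at `x` in any
orientation of the edge. -/
def HasEdgeDeriv (n : ℕ) (φ : Plane → ℝ) (x y : Plane) (t p : ℝ) : Prop :=
  HasDerivWithinAt (fun s => φ (edgeParam n x y s)) p (Icc 0 (edgeLength n)) t

/-- `φ` is a test function at the vertex `x` for the pair of edges from `x` to `y` and from `x`
to `z`, with derivative `p` into the first edge (hence `-p` into the second one). -/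
def IsVertexTest (a : Fin 3 → Plane) (n : ℕ) (φ : Plane → ℝ) (x y z : Plane) (p : ℝ) : Prop :=
  ContinuousOn φ (prefractal a n) ∧
    ∃ q, HasEdgeDeriv n φ x y 0 p ∧ HasEdgeDeriv n φ x z 0 q ∧ p + q = 0

/-- Upper semicontinuous viscosity subsolutions of `|Du| = f` on the network of level `n`
(off the boundary). Only the values on the network matter. -/
structure IsNetworkSubsolution (a : Fin 3 → Plane) (f : Plane → ℝ) (n : ℕ)
    (u : Plane → ℝ) : Prop where
  usc : UpperSemicontinuousOn u (prefractal a n)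
  edge : ∀ x y, Adj a n x y → ∀ t ∈ Ioo 0 (edgeLength n),
    ∀ (φ : Plane → ℝ) (p : ℝ), ContinuousOn φ (prefractal a n) → HasEdgeDeriv n φ x y t p →
      IsLocalMaxOn (fun z => u z - φ z) (prefractal a n) (edgeParam n x y t) →
      |p| ≤ f (edgeParam n x y t)
  vertex : ∀ x ∈ vertices a n \ corners a, ∀ y z, Adj a n x y → Adj a n x z → y ≠ z →
    ∀ (φ : Plane → ℝ) (p : ℝ), IsVertexTest a n φ x y z p →
      IsLocalMaxOn (fun z' => u z' - φ z') (segment ℝ x y ∪ segment ℝ x z) x →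
      |p| ≤ f x

/-- Lower semicontinuous viscosity supersolutions of `|Du| = f` on the network of level `n`
(off the boundary). At a vertex, each incident edge has a feasible partner. -/
structure IsNetworkSupersolution (a : Fin 3 → Plane) (f : Plane → ℝ) (n : ℕ)
    (v : Plane → ℝ) : Prop where
  lsc : LowerSemicontinuousOn v (prefractal a n)
  edge : ∀ x y, Adj a n x y → ∀ t ∈ Ioo 0 (edgeLength n),
    ∀ (φ : Plane → ℝ) (p : ℝ), ContinuousOn φ (prefractal a n) → HasEdgeDeriv n φ x y t p →
      IsLocalMinOn (fun z => v z - φ z) (prefractal a n) (edgeParam n x y t) →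
      f (edgeParam n x y t) ≤ |p|
  vertex : ∀ x ∈ vertices a n \ corners a, ∀ y, Adj a n x y →
    ∃ z, Adj a n x z ∧ z ≠ y ∧
      ∀ (φ : Plane → ℝ) (p : ℝ), IsVertexTest a n φ x y z p →
        IsLocalMinOn (fun z' => v z' - φ z') (segment ℝ x y ∪ segment ℝ x z) x →
        f x ≤ |p|

/-- Viscosity solutions of the Dirichlet problem `|Du| = f` on the network of level `n`,
`u = g` at the corners. -/
structure IsNetworkSolution (a : Fin 3 → Plane) (f : Plane → ℝ) (g : Fin 3 → ℝ) (n : ℕ)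
    (u : Plane → ℝ) : Prop where
  sub : IsNetworkSubsolution a f n u
  super : IsNetworkSupersolution a f n u
  boundary : ∀ i, u (a i) = g i

/-! ### Geodesic distance and curves on the gasket -/

/-- Continuous paths in the gasket, over `[0, 1]`, from `x` to `y`. -/
def paths (a : Fin 3 → Plane) (x y : Plane) : Set (ℝ → Plane) :=
  {γ | ContinuousOn γ (Icc 0 1) ∧ MapsTo γ (Icc 0 1) (gasket a) ∧ γ 0 = x ∧ γ 1 = y}

/-- The geodesic distance on the gasket: the infimum of the lengths of the paths in the gasket
that join two points (this infimum is finite for any two points of the gasket). -/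
def geoDist (a : Fin 3 → Plane) (x y : Plane) : ℝ :=
  (⨅ γ ∈ paths a x y, eVariationOn γ (Icc (0 : ℝ) 1)).toReal

/-- `m` is, almost everywhere in `I`, the metric derivative of `ξ` with respect to the geodesic
distance. -/
def IsMetricDeriv (a : Fin 3 → Plane) (I : Set ℝ) (ξ : ℝ → Plane) (m : ℝ → ℝ) : Prop :=
  ∀ᵐ t ∂(volume.restrict I),
    Tendsto (fun s => geoDist a (ξ s) (ξ t) / |s - t|) (𝓝[I \ {t}] t) (𝓝 (m t))

/-- The curves `ξ : I → Ω` in the subset `Ω` of the gasket, over the interval `I`, that are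
absolutely continuous with respect to the geodesic distance and have metric derivative at most
one almost everywhere. -/
def IsUnitCurve (a : Fin 3 → Plane) (I : Set ℝ) (Ω : Set Plane) (ξ : ℝ → Plane) : Prop :=
  MapsTo ξ I Ω ∧ ∃ m : ℝ → ℝ, IsMetricDeriv a I ξ m ∧ LocallyIntegrableOn m I volume ∧
    (∀ s ∈ I, ∀ t ∈ I, s ≤ t → geoDist a (ξ s) (ξ t) ≤ ∫ r in s..t, m r) ∧
    ∀ᵐ t ∂(volume.restrict I), m t ≤ 1

/-- Compatibility of the boundary data `g`: the value at a corner does not exceed the cost of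
any curve in the gasket to a corner plus the value there. -/
def Compatible (a : Fin 3 → Plane) (f : Plane → ℝ) (g : Fin 3 → ℝ) : Prop :=
  ∀ (i j : Fin 3) (T : ℝ) (ξ : ℝ → Plane), 0 < T → IsUnitCurve a (Icc 0 T) (gasket a) ξ →
    ξ 0 = a i → ξ T = a j → g i ≤ (∫ t in (0 : ℝ)..T, f (ξ t)) + g j

/-! ### Metric viscosity solutions on the gasket -/

/-- Arcwise upper semicontinuity on the gasket. -/
def ArcwiseUSC (a : Fin 3 → Plane) (u : Plane → ℝ) : Prop :=
  ∀ (I : Set ℝ) (ξ : ℝ → Plane), I.OrdConnected → IsUnitCurve a I (gasket a) ξ →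
    UpperSemicontinuousOn (fun t => u (ξ t)) I

/-- Arcwise lower semicontinuity on the gasket. -/
def ArcwiseLSC (a : Fin 3 → Plane) (u : Plane → ℝ) : Prop :=
  ∀ (I : Set ℝ) (ξ : ℝ → Plane), I.OrdConnected → IsUnitCurve a I (gasket a) ξ →
    LowerSemicontinuousOn (fun t => u (ξ t)) I

/-- The superdifferential of `w : ℝ → ℝ` at `t`. -/
def superdiff (w : ℝ → ℝ) (t : ℝ) : Set ℝ :=
  {p | ∀ ε > 0, ∀ᶠ s in 𝓝 t, w s ≤ w t + p * (s - t) + ε * |s - t|}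

/-- The subdifferential of `w : ℝ → ℝ` at `t`. -/
def subdiff (w : ℝ → ℝ) (t : ℝ) : Set ℝ :=
  {p | ∀ ε > 0, ∀ᶠ s in 𝓝 t, w t + p * (s - t) - ε * |s - t| ≤ w s}

/-- Metric viscosity subsolutions of `|Du| = f` in the gasket without the corners. -/
structure IsMetricSubsolution (a : Fin 3 → Plane) (f : Plane → ℝ) (u : Plane → ℝ) : Prop where
  usc : ArcwiseUSC a u
  visc : ∀ x ∈ gasket a \ corners a, ∀ (I : Set ℝ) (ξ : ℝ → Plane), I.OrdConnected → IsOpen I →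
    0 ∈ I → IsUnitCurve a I (gasket a \ corners a) ξ → ξ 0 = x →
    ∀ p ∈ superdiff (fun t => u (ξ t)) 0, |p| ≤ f x

/-- Metric viscosity supersolutions of `|Du| = f` in the gasket without the corners. Here `Tp`
and `Tm` are the exit and entrance times of the curve `ξ`; that they are real numbers says that
both are finite. -/
structure IsMetricSupersolution (a : Fin 3 → Plane) (f : Plane → ℝ) (v : Plane → ℝ) : Prop where
  lsc : ArcwiseLSC a v
  visc : ∀ x ∈ gasket a \ corners a, ∀ ε > 0, ∃ (ξ : ℝ → Plane) (w : ℝ → ℝ) (Tm Tp : ℝ),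
    IsUnitCurve a univ (gasket a) ξ ∧ ξ 0 = x ∧ LowerSemicontinuous w ∧
    IsGLB {t | 0 ≤ t ∧ ξ t ∈ corners a} Tp ∧ IsLUB {t | t ≤ 0 ∧ ξ t ∈ corners a} Tm ∧
    w 0 = v x ∧ (∀ t ∈ Ioo Tm Tp, v (ξ t) - ε ≤ w t) ∧
    ∀ t ∈ Ioo Tm Tp, ∀ p ∈ subdiff w t, f (ξ t) - ε ≤ |p|

/-- Metric viscosity solutions of the Dirichlet problem `|Du| = f` in the gasket without the
corners, `u = g` at the corners. Only the values on the gasket matter. -/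
structure IsMetricSolution (a : Fin 3 → Plane) (f : Plane → ℝ) (g : Fin 3 → ℝ)
    (u : Plane → ℝ) : Prop where
  sub : IsMetricSubsolution a f u
  super : IsMetricSupersolution a f u
  boundary : ∀ i, u (a i) = g i

end SierpinskiEikonal

end

/-!
The metric viscosity solution is the value function `value a f g x`, the least cost `∫ f` of a
curve in the gasket from `x` to a corner plus the boundary value there; the network solution is
the value function `networkValue a f g n` for paths in the network.

*One-dimensional core.* On an interval, viscosity inequalities for `|w'| = F` with `F > 0` give
explicit bounds. A subsolution varies by at most `∫ F`
(`abs_sub_le_integral_of_touching_above`). A supersolution dominates the minimum of the two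
one-sided solutions that start from its end values (`min_add_integral_le_of_touching_below`).
Uniqueness reduces to these bounds. Along a curve, a metric subsolution is at most the cost up to
the first corner, and compatibility covers the rest of the curve. Along the curve of the
supersolution property, the second bound produces a path to a corner whose cost, boundary value
included, is at most the value of the solution, up to a multiple of `ε`. On a network, the second
bound on the union of two edges shows that a solution descends from each vertex other than a
corner to a neighbour at rate at least `f`, which gives comparison because there are finitely
many vertices.

*Curves.* Geodesic unit curves are the same as Euclidean `1`-Lipschitz curves in the gasket
(`IsUnitCurve.dist_le`, `IsLipCurve.isUnitCurve`). The geodesic distance lies between the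
Euclidean distance and the length, so the norm of the derivative of a Lipschitz curve is its
metric derivative. That the geodesic distance is finite, and that two points of a cell of level
`n` are joined by a curve of length `3 * 2 ^ (-n)` inside the gasket, follows from a compactness
argument for Lipschitz curves (`exists_isLipCurve_corner`); the second fact makes `value`
continuous.

*Geometry.* In barycentric coordinates, two cells of the same level that are different meet at
most in a common corner (`cells_inter`). Hence an interior point of an edge lies on no other edge,
and `networkValue` is given on each edge by its end values (`networkValue_edge`).

*Convergence.* Network solutions dominate `value` by comparison. Conversely, if `f` oscillates by
at most `ε` on the cells of level `n`, the vertex values of the network solution extend to a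
function on the gasket that is Lipschitz on each cell with a constant at most `f + 2 * ε`
(`IsNetworkSolution.exists_extension`). The different extensions fit together since cells meet
only in corners. This function grows at rate at most `f + 2 * ε` along every curve, so it exceeds
`value` by a multiple of `ε` only.
-/

noncomputable section

namespace SierpinskiEikonal

/-! ### Viscosity inequalities on an interval -/

/-- A lower semicontinuous function on an interval whose test functions from below have slope at
least `F` in absolute value dominates the explicit solution of `|w'| = F` with the same end
values. The barrier is a smooth lower approximation of the minimum of the two one-sided solutions
`A` and `B`; since `A + B` is constant, its slope is strictly below `F`. -/
lemma min_add_integral_le_of_touching_below {w F : ℝ → ℝ} {α β : ℝ}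
    (hw : LowerSemicontinuousOn w (Icc α β)) (hF : Continuous F) (hpos : ∀ t, 0 < F t)
    (H : ∀ t ∈ Ioo α β, ∀ (φ : ℝ → ℝ) (p : ℝ), Continuous φ → HasDerivAt φ p t →
      IsMinOn (fun s => w s - φ s) (Icc α β) t → F t ≤ |p|)
    {t : ℝ} (ht : t ∈ Icc α β) :
    min (w α + ∫ s in α..t, F s) (w β + ∫ s in t..β, F s) ≤ w t := by
  by_contra! hlt
  set A : ℝ → ℝ := fun s => w α + ∫ r in α..s, F r with hA
  set B : ℝ → ℝ := fun s => w β + ∫ r in s..β, F r with hB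
  set δ : ℝ := min (A t) (B t) - w t with hδ
  have hδ0 : 0 < δ := sub_pos.2 hlt
  have hA' : ∀ s, HasDerivAt A (F s) s := fun s =>
    (intervalIntegral.integral_hasDerivAt_right (hF.intervalIntegrable _ _)
      (hF.stronglyMeasurableAtFilter _ _) hF.continuousAt).const_add _
  have hB' : ∀ s, HasDerivAt B (-F s) s := fun s =>
    (intervalIntegral.integral_hasDerivAt_left (hF.intervalIntegrable _ _)
      (hF.stronglyMeasurableAtFilter _ _) hF.continuousAt).const_add _
  set R : ℝ → ℝ := fun s => √((A s - B s) ^ 2 + δ ^ 2) with hR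
  set N : ℝ → ℝ := fun s => (A s + B s - R s) / 2 with hN
  have hRpos : ∀ s, 0 < (A s - B s) ^ 2 + δ ^ 2 := fun s => by positivity
  have hRabs : ∀ s, |A s - B s| < R s := fun s => by
    rw [hR, ← Real.sqrt_sq_eq_abs]
    exact Real.sqrt_lt_sqrt (sq_nonneg _) (by linarith [pow_pos hδ0 2])
  have hRle : ∀ s, R s ≤ |A s - B s| + δ := fun s => by
    refine Real.sqrt_le_iff.2 ⟨by positivity, ?_⟩
    nlinarith [sq_abs (A s - B s), abs_nonneg (A s - B s)]
  have hN' : ∀ s, HasDerivAt N (-((A s - B s) / R s * F s)) s := fun s => by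
    have h1 := (((hA' s).sub (hB' s)).pow 2).add_const (δ ^ 2)
    have h2 := (((hA' s).add (hB' s)).sub (h1.sqrt (hRpos s).ne')).div_const 2
    refine h2.congr_deriv ?_
    have : R s ≠ 0 := ((abs_nonneg _).trans_lt (hRabs s)).ne'
    simp only [Pi.sub_apply, Pi.pow_apply, hR] at this ⊢
    field_simp
    ring
  have hNc : Continuous N :=
    continuous_iff_continuousAt.2 fun s => (hN' s).continuousAt
  have hNA : ∀ s, N s ≤ A s := fun s => by
    have := neg_abs_le (A s - B s); have := hRabs s; simp only [hN]; linarith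
  have hNB : ∀ s, N s ≤ B s := fun s => by
    have := le_abs_self (A s - B s); have := hRabs s; simp only [hN]; linarith
  have hNt : w t < N t := by
    have h1 := hRle t
    have h2 := min_add_max (A t) (B t)
    have h3 := max_sub_min_eq_abs (A t) (B t)
    have h4 : |A t - B t| = |B t - A t| := abs_sub_comm _ _
    simp only [hN]
    linarith
  have hlsc : LowerSemicontinuousOn (fun s => w s - N s) (Icc α β) := by
    simp only [sub_eq_add_neg]
    exact hw.add hNc.neg.continuousOn.lowerSemicontinuousOn
  obtain ⟨t₁, ht₁, hmin⟩ := hlsc.exists_isMinOn ⟨t, ht⟩ isCompact_Icc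
  have hneg : w t₁ - N t₁ < 0 := (hmin ht).trans_lt (by simpa using hNt)
  have hα : t₁ ≠ α := fun h => by
    have := hNA α; rw [h] at hneg; simp only [hA, intervalIntegral.integral_same] at this; linarith
  have hβ : t₁ ≠ β := fun h => by
    have := hNB β; rw [h] at hneg; simp only [hB, intervalIntegral.integral_same] at this; linarith
  have h1 := H t₁ ⟨ht₁.1.lt_of_ne' hα, ht₁.2.lt_of_ne hβ⟩ N _ hNc (hN' t₁) hmin
  have hR1 : 0 < R t₁ := (abs_nonneg _).trans_lt (hRabs t₁)
  rw [abs_neg, abs_mul, abs_div, abs_of_pos (hpos t₁), abs_of_pos hR1] at h1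
  have h2 : |A t₁ - B t₁| / R t₁ < 1 := (div_lt_one hR1).2 (hRabs t₁)
  nlinarith [hpos t₁]

/-- A continuous function on an interval whose test functions from above have slope at most `F`
grows at most like a primitive of `F`. A steep monomial centred at the left end pushes the
maximum of the difference away from the right end. -/
lemma le_add_integral_of_touching_above {u F : ℝ → ℝ} {α β : ℝ} (hαβ : α ≤ β)
    (hu : ContinuousOn u (Icc α β)) (hF : Continuous F)
    (H : ∀ t ∈ Ioo α β, ∀ (φ : ℝ → ℝ) (p : ℝ), Continuous φ → HasDerivAt φ p t →
      IsMaxOn (fun s => u s - φ s) (Icc α β) t → p ≤ F t) :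
    u β ≤ u α + ∫ s in α..β, F s := by
  by_contra! hlt
  have hlt' : α < β := hαβ.lt_of_ne fun h => by subst h; simp at hlt
  set δ : ℝ := (u β - (u α + ∫ s in α..β, F s)) / (2 * (β - α)) with hδ
  have hβα : 0 < β - α := sub_pos.2 hlt'
  have hδ0 : 0 < δ := div_pos (sub_pos.2 hlt) (by positivity)
  set P : ℝ → ℝ := fun s => (∫ r in α..s, F r) + δ * (s - α) with hP
  have hP' : ∀ s, HasDerivAt P (F s + δ) s := fun s => by
    refine (intervalIntegral.integral_hasDerivAt_right (hF.intervalIntegrable _ _)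
      (hF.stronglyMeasurableAtFilter _ _) hF.continuousAt).add ?_
    simpa using ((hasDerivAt_id s).sub_const α).const_mul δ
  have hPc : Continuous P := continuous_iff_continuousAt.2 fun s => (hP' s).continuousAt
  have hPα : P α = 0 := by simp [hP]
  have hψβ : u α < u β - P β := by
    have : δ * (β - α) = (u β - (u α + ∫ s in α..β, F s)) / 2 := by
      rw [hδ]; field_simp
    simp only [hP, this]; linarith
  have hψc : ContinuousOn (fun s => u s - P s) (Icc α β) := hu.sub hPc.continuousOn
  -- a point left of `β` where the difference still exceeds its value at `α`
  obtain ⟨t₀, ht₀, ht₀ψ⟩ : ∃ t₀ ∈ Ioo α β, u α < u t₀ - P t₀ := by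
    have h1 : ∀ᶠ s in 𝓝[Icc α β] β, u α < u s - P s :=
      (hψc β (right_mem_Icc.2 hαβ)).eventually (lt_mem_nhds hψβ)
    have h2 : ∀ᶠ s in 𝓝[<] β, u α < u s - P s :=
      (nhdsWithin_Ico_eq_nhdsLT hlt') ▸ h1.filter_mono (nhdsWithin_mono _ Ico_subset_Icc_self)
    exact (h2.and (Ioo_mem_nhdsLT hlt')).exists.imp fun _ h => ⟨h.2, h.1⟩
  have ht₀α : 0 < t₀ - α := sub_pos.2 ht₀.1
  set η : ℝ := (u t₀ - P t₀ - u α) / 2 with hη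
  have hη0 : 0 < η := by rw [hη]; linarith
  obtain ⟨m, hm⟩ := pow_unbounded_of_one_lt ((u β - P β - u α) / η)
    (show 1 < (β - α) / (t₀ - α) from (one_lt_div ht₀α).2 (by linarith [ht₀.2]))
  set Q : ℝ → ℝ := fun s => η * ((s - α) / (t₀ - α)) ^ (m + 1) with hQ
  set q : ℝ → ℝ := fun s => η * ((m + 1 : ℕ) * ((s - α) / (t₀ - α)) ^ m * (1 / (t₀ - α))) with hq
  have hQ' : ∀ s, HasDerivAt Q (q s) s := fun s => by
    have := (((((hasDerivAt_id s).sub_const α).div_const (t₀ - α)).pow (m + 1))).const_mul η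
    simpa [hQ, hq] using this
  have hQc : Continuous Q := continuous_iff_continuousAt.2 fun s => (hQ' s).continuousAt
  have hQα : Q α = 0 := by simp [hQ]
  have hQt₀ : Q t₀ = η := by simp [hQ, div_self ht₀α.ne']
  have hQβ : u β - P β - u α < Q β := by
    rw [div_lt_iff₀' hη0] at hm
    refine hm.trans_le ?_
    simp only [hQ]
    gcongr
    · exact ((one_lt_div ht₀α).2 (by linarith [ht₀.2])).le
    · omega
  obtain ⟨t₁, ht₁, hmax⟩ := isCompact_Icc.exists_isMaxOn ⟨α, left_mem_Icc.2 hαβ⟩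
    (hψc.sub hQc.continuousOn)
  have hbig : u α < u t₁ - P t₁ - Q t₁ := by
    have : u t₀ - P t₀ - Q t₀ ≤ u t₁ - P t₁ - Q t₁ := hmax (Ioo_subset_Icc_self ht₀)
    rw [hQt₀] at this
    linarith
  have hα : t₁ ≠ α := fun h => by rw [h, hPα, hQα] at hbig; linarith
  have hβ : t₁ ≠ β := fun h => by rw [h] at hbig; linarith
  have h1 := H t₁ ⟨ht₁.1.lt_of_ne' hα, ht₁.2.lt_of_ne hβ⟩ (fun s => P s + Q s) _ (hPc.add hQc)
    ((hP' t₁).add (hQ' t₁)) (fun s hs => by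
      have : u s - P s - Q s ≤ u t₁ - P t₁ - Q t₁ := hmax hs
      show u s - (P s + Q s) ≤ u t₁ - (P t₁ + Q t₁)
      linarith)
  have : 0 ≤ q t₁ := by
    have := ht₁.1
    have : 0 ≤ t₁ - α := by linarith
    simp only [hq]; positivity
  linarith

/-- The two-sided form of `le_add_integral_of_touching_above`. -/
lemma abs_sub_le_integral_of_touching_above {u F : ℝ → ℝ} {α β : ℝ} (hαβ : α ≤ β)
    (hu : ContinuousOn u (Icc α β)) (hF : Continuous F)
    (H : ∀ t ∈ Ioo α β, ∀ (φ : ℝ → ℝ) (p : ℝ), Continuous φ → HasDerivAt φ p t →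
      IsMaxOn (fun s => u s - φ s) (Icc α β) t → |p| ≤ F t) :
    |u α - u β| ≤ ∫ s in α..β, F s := by
  have h1 := le_add_integral_of_touching_above hαβ hu hF
    fun t ht φ p h h' h'' => (le_abs_self p).trans (H t ht φ p h h' h'')
  -- the reflection of the interval reduces the other inequality to the first one
  have hmap : MapsTo (fun s => α + β - s) (Icc α β) (Icc α β) := fun s hs =>
    ⟨by linarith [hs.2], by linarith [hs.1]⟩
  have hc : Continuous fun s : ℝ => α + β - s := by fun_prop
  have h2 := le_add_integral_of_touching_above (u := fun s => u (α + β - s))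
    (F := fun s => F (α + β - s)) hαβ (hu.comp hc.continuousOn hmap) (hF.comp hc)
    fun t ht φ p h h' h'' => by
      have h3 : HasDerivAt (fun s => φ (α + β - s)) (-p) (α + β - t) := by
        have h4 : HasDerivAt (fun s : ℝ => α + β - s) (-1) (α + β - t) := by
          simpa using (hasDerivAt_id (α + β - t)).const_sub (α + β)
        have h5 : HasDerivAt φ p (α + β - (α + β - t)) := by simpa using h'
        simpa [Function.comp_def] using h5.comp (α + β - t) h4
      have := H (α + β - t) ⟨by linarith [ht.2], by linarith [ht.1]⟩ (fun s => φ (α + β - s)) (-p)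
        (h.comp hc) h3 fun s hs => by
          have := h'' (hmap hs)
          simpa using this
      rw [abs_neg] at this
      exact (le_abs_self p).trans this
  have h3 : ∫ s in α..β, F (α + β - s) = ∫ s in α..β, F s := by
    rw [intervalIntegral.integral_comp_sub_left F (α + β)]; simp
  simp only [add_sub_cancel_right, h3, add_sub_cancel_left] at h2
  rw [abs_le]
  constructor <;> linarith

/-- The slope of a function that touches `w` from below belongs to the subdifferential. -/
lemma mem_subdiff_of_isLocalMin {w φ : ℝ → ℝ} {t p : ℝ} (hφ : HasDerivAt φ p t)
    (h : IsLocalMin (fun s => w s - φ s) t) : p ∈ subdiff w t := by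
  intro ε hε
  filter_upwards [h, (hasDerivAt_iff_isLittleO.1 hφ).def hε] with s hs hs'
  rw [Real.norm_eq_abs, Real.norm_eq_abs, smul_eq_mul] at hs'
  have := neg_abs_le (φ s - φ t - (s - t) * p)
  linarith

/-- The slope of a function that touches `w` from above belongs to the superdifferential. -/
lemma mem_superdiff_of_isLocalMax {w φ : ℝ → ℝ} {t p : ℝ} (hφ : HasDerivAt φ p t)
    (h : IsLocalMax (fun s => w s - φ s) t) : p ∈ superdiff w t := by
  intro ε hε
  filter_upwards [h, (hasDerivAt_iff_isLittleO.1 hφ).def hε] with s hs hs'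
  rw [Real.norm_eq_abs, Real.norm_eq_abs, smul_eq_mul] at hs'
  have := le_abs_self (φ s - φ t - (s - t) * p)
  linarith

variable {a : Fin 3 → Plane}

/-! ### Cells of the gasket -/

lemma contraction_add_smul (p x v : Plane) (t : ℝ) :
    contraction p (x + t • v) = contraction p x + t • ((1 / 2 : ℝ) • v) := by
  simp only [contraction]; module

lemma dist_contraction (p x y : Plane) :
    dist (contraction p x) (contraction p y) = dist x y / 2 := by
  have : contraction p x - contraction p y = (1 / 2 : ℝ) • (x - y) := by
    simp only [contraction]; module
  rw [dist_eq_norm, dist_eq_norm, this, norm_smul]; norm_num; ring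

lemma continuous_contraction (p : Plane) : Continuous (contraction p) := by
  unfold contraction; fun_prop

lemma contraction_self (p : Plane) : contraction p p = p := by simp [contraction]

lemma cellMap_cons (i : Fin 3) (w : List (Fin 3)) (x : Plane) :
    cellMap a (i :: w) x = contraction (a i) (cellMap a w x) := rfl

lemma cellMap_append (w w' : List (Fin 3)) (x : Plane) :
    cellMap a (w ++ w') x = cellMap a w (cellMap a w' x) := by
  induction w with
  | nil => rfl
  | cons i w ih => rw [List.cons_append, cellMap_cons, ih, cellMap_cons]

lemma dist_cellMap (w : List (Fin 3)) (x y : Plane) :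
    dist (cellMap a w x) (cellMap a w y) = dist x y / 2 ^ w.length := by
  induction w with
  | nil => simp [cellMap]
  | cons i w ih => rw [cellMap_cons, cellMap_cons, dist_contraction, ih, List.length_cons]; ring

lemma continuous_cellMap (w : List (Fin 3)) : Continuous (cellMap a w) := by
  induction w with
  | nil => exact continuous_id
  | cons i w ih => exact (continuous_contraction _).comp ih

lemma cellMap_lineMap (w : List (Fin 3)) (x y : Plane) (t : ℝ) :
    cellMap a w (x + t • (y - x)) = cellMap a w x + t • (cellMap a w y - cellMap a w x) := by
  induction w with
  | nil => rfl
  | cons i w ih =>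
    simp only [cellMap_cons, ih, contraction_add_smul]
    simp only [contraction]; module

lemma corner_mem_vertices (n : ℕ) (i : Fin 3) : a i ∈ vertices a n := by
  refine ⟨List.replicate n i, List.length_replicate, a i, ⟨i, rfl⟩, ?_⟩
  induction n with
  | zero => rfl
  | succ n ih => rw [List.replicate_succ, cellMap_cons, ih, contraction_self]

lemma vertices_subset_succ (n : ℕ) : vertices a n ⊆ vertices a (n + 1) := by
  rintro _ ⟨w, hw, _, ⟨i, rfl⟩, rfl⟩
  refine ⟨w ++ [i], by simp [hw], a i, ⟨i, rfl⟩, ?_⟩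
  rw [cellMap_append, cellMap_cons]
  simp only [cellMap, id, contraction_self]

lemma vertices_mono : Monotone (vertices a) := monotone_nat_of_le_succ vertices_subset_succ

lemma vertices_subset_gasket (n : ℕ) : vertices a n ⊆ gasket a :=
  (subset_iUnion _ n).trans subset_closure

lemma corner_mem_gasket (i : Fin 3) : a i ∈ gasket a :=
  vertices_subset_gasket 0 (corner_mem_vertices 0 i)

lemma isClosed_gasket : IsClosed (gasket a) := isClosed_closure

lemma cellMap_mem_gasket (w : List (Fin 3)) {x : Plane} (hx : x ∈ gasket a) :
    cellMap a w x ∈ gasket a := by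
  refine map_mem_closure (continuous_cellMap w) hx fun y hy => ?_
  obtain ⟨n, w', hw', z, hz, rfl⟩ := mem_iUnion.1 hy
  exact mem_iUnion.2 ⟨w.length + n, w ++ w', by simp [hw'], z, hz, cellMap_append _ _ _⟩

lemma finite_words (n : ℕ) : {w : List (Fin 3) | w.length = n}.Finite :=
  List.finite_length_eq (Fin 3) n

lemma finite_vertices (n : ℕ) : (vertices a n).Finite := by
  have : vertices a n = ⋃ w ∈ {w : List (Fin 3) | w.length = n}, cellMap a w '' corners a := by
    ext x; simp [vertices]
  rw [this]
  exact (finite_words n).biUnion fun w _ => (finite_range a).image _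

lemma gasket_subset_convexHull : gasket a ⊆ convexHull ℝ (corners a) := by
  refine closure_minimal ?_ ((finite_range a).isCompact_convexHull ℝ).isClosed
  refine iUnion_subset fun n => ?_
  rintro _ ⟨w, -, x, hx, rfl⟩
  clear n
  induction w with
  | nil => exact subset_convexHull ℝ _ hx
  | cons i w ih =>
    have h1 : a i ∈ convexHull ℝ (corners a) := subset_convexHull ℝ _ ⟨i, rfl⟩
    have h2 := (convex_convexHull ℝ (corners a)).add_smul_sub_mem h1 ih
      (t := 1 / 2) ⟨by norm_num, by norm_num⟩
    exact h2

lemma isCompact_gasket : IsCompact (gasket a) :=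
  ((finite_range a).isCompact_convexHull ℝ).of_isClosed_subset isClosed_gasket
    gasket_subset_convexHull

lemma dist_le_one_of_mem_gasket (ha : ∀ i j, i ≠ j → dist (a i) (a j) = 1) {x y : Plane}
    (hx : x ∈ gasket a) (hy : y ∈ gasket a) : dist x y ≤ 1 := by
  obtain ⟨x', ⟨i, rfl⟩, y', ⟨j, rfl⟩, h⟩ := convexHull_exists_dist_ge2
    (gasket_subset_convexHull hx) (gasket_subset_convexHull hy)
  refine h.trans ?_
  by_cases hij : i = j
  · simp [hij]
  · exact (ha i j hij).le

lemma norm_corner_sub_le (ha : ∀ i j, i ≠ j → dist (a i) (a j) = 1) (i j : Fin 3) :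
    ‖a j - a i‖ ≤ 1 := by
  rw [← dist_eq_norm]
  exact dist_le_one_of_mem_gasket ha (corner_mem_gasket j) (corner_mem_gasket i)

lemma exists_weights {x : Plane} (hx : x ∈ gasket a) :
    ∃ p : Fin 3 → ℝ, (∀ i, 0 ≤ p i) ∧ ∑ i, p i = 1 ∧ ∑ i, p i • a i = x := by
  refine convexHull_min (s := corners a) (t := {x | ∃ p : Fin 3 → ℝ, (∀ i, 0 ≤ p i) ∧
    ∑ i, p i = 1 ∧ ∑ i, p i • a i = x}) ?_ ?_ (gasket_subset_convexHull hx)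
  · rintro _ ⟨i, rfl⟩
    refine ⟨Pi.single i 1, fun j => ?_, by simp, by simp [Pi.single_apply]⟩
    by_cases h : j = i <;> simp [h]
  · rintro _ ⟨p, hp0, hp1, rfl⟩ _ ⟨q, hq0, hq1, rfl⟩ s t hs ht hst
    refine ⟨fun i => s * p i + t * q i, fun i => ?_, ?_, ?_⟩
    · have := hp0 i; have := hq0 i; positivity
    · rw [Finset.sum_add_distrib, ← Finset.mul_sum, ← Finset.mul_sum, hp1, hq1]; linarith
    · simp only [add_smul, mul_smul, Finset.sum_add_distrib, Finset.smul_sum]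

/-- Barycentric coordinates with respect to the equilateral triangle are unique. -/
lemma weights_unique (ha : ∀ i j, i ≠ j → dist (a i) (a j) = 1) {p q : Fin 3 → ℝ}
    (h1 : ∑ i, p i = ∑ i, q i) (h2 : ∑ i, p i • a i = ∑ i, q i • a i) : p = q := by
  simp only [Fin.sum_univ_three] at h1 h2
  set s := p 1 - q 1 with hs
  set t := p 2 - q 2 with ht
  set v := a 1 - a 0 with hv
  set v' := a 2 - a 0 with hv'
  have h3 : s • v + t • v' = 0 := by
    have h0 : p 0 - q 0 = -s - t := by rw [hs, ht]; linarith
    have : (p 0 - q 0) • a 0 + s • a 1 + t • a 2 = 0 := by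
      rw [hs, ht, ← sub_eq_zero.2 h2]; module
    rw [h0] at this
    rw [← this, hv, hv']; module
  have n1 : ‖v‖ = 1 := by rw [hv, ← dist_eq_norm]; exact ha _ _ (by decide)
  have n2 : ‖v'‖ = 1 := by rw [hv', ← dist_eq_norm]; exact ha _ _ (by decide)
  have n3 : ‖v - v'‖ = 1 := by
    rw [hv, hv', sub_sub_sub_cancel_right, ← dist_eq_norm]; exact ha _ _ (by decide)
  have hin : inner ℝ v v' = 1 / 2 := by
    have := norm_sub_sq_real v v'
    rw [n1, n2, n3] at this; linarith
  have h4 : s ^ 2 + s * t + t ^ 2 = 0 := by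
    have := norm_add_sq_real (s • v) (t • v')
    rw [h3, norm_zero, norm_smul, norm_smul, n1, n2, inner_smul_left, inner_smul_right, hin,
      mul_one, mul_one, Real.norm_eq_abs, Real.norm_eq_abs, sq_abs, sq_abs] at this
    simp only [conj_trivial] at this
    linarith
  have hs0 : s = 0 := by nlinarith [sq_nonneg (s + 2 * t), sq_nonneg s]
  have ht0 : t = 0 := by nlinarith [sq_nonneg (t + 2 * s), sq_nonneg t]
  ext i
  fin_cases i <;> simp only [Fin.zero_eta, Fin.mk_one, Fin.reduceFinMk] <;> linarith

/-- The numerators, over the denominator `2 ^ w.length`, of the least barycentric coordinates of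
the points of the cell of the word `w`. -/
def cellIndex : List (Fin 3) → Fin 3 → ℕ
  | [], _ => 0
  | i :: w, j => (if j = i then 2 ^ w.length else 0) + cellIndex w j

lemma sum_cellIndex (w : List (Fin 3)) : ∑ j, cellIndex w j + 1 = 2 ^ w.length := by
  induction w with
  | nil => simp [cellIndex]
  | cons i w ih =>
    simp only [cellIndex, Finset.sum_add_distrib, Finset.sum_ite_eq', Finset.mem_univ, if_true,
      List.length_cons, pow_succ]
    omega

lemma cellMap_sum_smul (w : List (Fin 3)) (p : Fin 3 → ℝ) :
    cellMap a w (∑ j, p j • a j) =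
      ∑ j, ((cellIndex w j + p j) / 2 ^ w.length) • a j := by
  induction w with
  | nil => simp [cellMap, cellIndex]
  | cons i w ih =>
    rw [cellMap_cons, ih, contraction]
    have : ∀ j, ((cellIndex (i :: w) j + p j) / 2 ^ (i :: w).length) • a j =
        (if j = i then (1 / 2 : ℝ) • a j else 0) +
          (1 / 2 : ℝ) • (((cellIndex w j + p j) / 2 ^ w.length) • a j) := by
      intro j
      by_cases h : j = i
      · simp only [cellIndex, h, if_true, List.length_cons, smul_smul, ← add_smul, pow_succ]
        congr 1
        push_cast
        field_simp
        ring
      · simp only [cellIndex, h, if_false, List.length_cons, smul_smul, zero_add, pow_succ]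
        congr 1
        field_simp
    rw [Finset.sum_congr rfl fun j _ => this j, Finset.sum_add_distrib, ← Finset.smul_sum]
    simp only [Finset.sum_ite_eq', Finset.mem_univ, if_true]
    module

lemma single_sum_smul (i : Fin 3) : ∑ j, (Pi.single i (1 : ℝ) : Fin 3 → ℝ) j • a j = a i := by
  simp [Pi.single_apply]

/-- Two cells of the same level are equal or meet at most in a common corner. In barycentric
coordinates scaled by `2 ^ n`, a common point dominates both index vectors, hence their maximum;
if they differ, the sum of the maximum is already the sum of the coordinates of the point. -/
lemma cells_inter (ha : ∀ i j, i ≠ j → dist (a i) (a j) = 1) {w w' : List (Fin 3)}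
    (hw : w.length = w'.length) {x x' : Plane} (hx : x ∈ gasket a) (hx' : x' ∈ gasket a)
    (h : cellMap a w x = cellMap a w' x') :
    EqOn (cellMap a w) (cellMap a w') (gasket a) ∨ (∃ i, x = a i) ∧ ∃ j, x' = a j := by
  obtain ⟨p, hp0, hp1, rfl⟩ := exists_weights hx
  obtain ⟨q, hq0, hq1, rfl⟩ := exists_weights hx'
  rw [cellMap_sum_smul, cellMap_sum_smul, hw] at h
  have hk := sum_cellIndex w
  have hk' := sum_cellIndex w'
  have hkR : (∑ j, (cellIndex w j : ℝ)) + 1 = 2 ^ w'.length := by rw [← hw]; exact_mod_cast hk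
  have hkR' : (∑ j, (cellIndex w' j : ℝ)) + 1 = 2 ^ w'.length := by exact_mod_cast hk'
  have hpos : (0 : ℝ) < 2 ^ w'.length := by positivity
  have heq : ∀ j, (cellIndex w j : ℝ) + p j = cellIndex w' j + q j := by
    have := weights_unique ha (p := fun j => (cellIndex w j + p j) / 2 ^ w'.length)
      (q := fun j => (cellIndex w' j + q j) / 2 ^ w'.length) (by
        rw [← Finset.sum_div, ← Finset.sum_div, Finset.sum_add_distrib, Finset.sum_add_distrib,
          hp1, hq1, hkR, hkR']) h
    intro j
    have := congrFun this j
    simpa only [div_left_inj' hpos.ne'] using this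
  by_cases hkk : cellIndex w = cellIndex w'
  · left
    intro y hy
    obtain ⟨r, -, -, rfl⟩ := exists_weights hy
    rw [cellMap_sum_smul, cellMap_sum_smul, hw, hkk]
  · right
    -- an integer vector of nonnegative coordinates with sum one is a corner
    have key : ∀ (k k' : Fin 3 → ℕ) (p q : Fin 3 → ℝ), (∀ i, 0 ≤ p i) → (∀ i, 0 ≤ q i) →
        ∑ i, p i = 1 → ∑ j, k j = ∑ j, k' j → k ≠ k' →
        (∀ j, (k j : ℝ) + p j = k' j + q j) → ∃ i, ∑ j, p j • a j = a i := by
      intro k k' p q hp0 hq0 hp1 hs hne heq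
      have : ∃ i, k i < k' i := by
        by_contra! hle
        exact hne (funext fun i => le_antisymm
          ((Finset.sum_eq_sum_iff_of_le fun i _ => hle i).1 hs.symm i (Finset.mem_univ i)).ge
            (hle i))
      obtain ⟨i, hi⟩ := this
      have hpi : 1 ≤ p i := by
        have h1 := heq i
        have h2 : (k i : ℝ) + 1 ≤ k' i := by exact_mod_cast hi
        linarith [hq0 i]
      have hp : p = Pi.single i 1 := by
        ext j
        have h3 := Finset.add_sum_erase Finset.univ p (Finset.mem_univ i)
        have h4 : 0 ≤ ∑ j ∈ Finset.univ.erase i, p j := Finset.sum_nonneg fun j _ => hp0 j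
        by_cases hj : j = i
        · subst hj; simp; linarith
        · have h5 : p j ≤ ∑ j ∈ Finset.univ.erase i, p j :=
            Finset.single_le_sum (fun j _ => hp0 j) (Finset.mem_erase.2 ⟨hj, Finset.mem_univ _⟩)
          simp only [Pi.single_apply, hj, if_false]
          linarith [hp0 j]
      exact ⟨i, by rw [hp, single_sum_smul]⟩
    have hsum : ∑ j, cellIndex w j = ∑ j, cellIndex w' j := by rw [hw] at hk; omega
    exact ⟨key _ _ p q hp0 hq0 hp1 hsum hkk heq,
      key _ _ q p hq0 hp0 hq1 hsum.symm (Ne.symm hkk) fun j => (heq j).symm⟩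

lemma cellMap_injective (w : List (Fin 3)) : Function.Injective (cellMap a w) := fun x y h => by
  have := dist_cellMap (a := a) w x y
  rw [h, dist_self, eq_comm, div_eq_zero_iff] at this
  exact dist_eq_zero.1 (this.resolve_right (by positivity))

/-- Every point of the gasket lies in a cell of level `n`. -/
lemma exists_cell (n : ℕ) {x : Plane} (hx : x ∈ gasket a) :
    ∃ w : List (Fin 3), w.length = n ∧ x ∈ cellMap a w '' gasket a := by
  have hcl : IsClosed (⋃ w ∈ {w : List (Fin 3) | w.length = n}, cellMap a w '' gasket a) :=
    (finite_words n).isClosed_biUnion fun w _ =>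
      (isCompact_gasket.image (continuous_cellMap w)).isClosed
  have hsub : (⋃ m, vertices a m) ⊆
      ⋃ w ∈ {w : List (Fin 3) | w.length = n}, cellMap a w '' gasket a := by
    refine iUnion_subset fun m x hx => ?_
    obtain ⟨w, hw, y, hy, rfl⟩ := vertices_mono (le_max_left m n) hx
    refine mem_biUnion (x := w.take n) (by simp [hw]) ⟨cellMap a (w.drop n) y, ?_, ?_⟩
    · obtain ⟨i, rfl⟩ := hy
      exact cellMap_mem_gasket _ (corner_mem_gasket i)
    · rw [← cellMap_append, List.take_append_drop]
  simpa using closure_minimal hsub hcl hx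

/-- Near a point `x` of the gasket, only the cells of level `n` that contain `x` are met. -/
lemma eventually_common_cell (n : ℕ) (x : Plane) :
    ∀ᶠ y in 𝓝[gasket a] x, ∃ w : List (Fin 3), w.length = n ∧
      x ∈ cellMap a w '' gasket a ∧ y ∈ cellMap a w '' gasket a := by
  have h : ∀ᶠ y in 𝓝 x, ∀ w ∈ {w : List (Fin 3) | w.length = n},
      x ∉ cellMap a w '' gasket a → y ∉ cellMap a w '' gasket a := by
    refine (finite_words n).eventually_all.2 fun w _ => ?_
    by_cases hxw : x ∈ cellMap a w '' gasket a
    · exact Eventually.of_forall fun y h => absurd hxw h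
    · have := (isCompact_gasket.image (continuous_cellMap w)).isClosed.isOpen_compl.mem_nhds hxw
      filter_upwards [this] with y hy _ using hy
  filter_upwards [h.filter_mono nhdsWithin_le_nhds, self_mem_nhdsWithin] with y hy hyS
  obtain ⟨w, hw, hyw⟩ := exists_cell n hyS
  exact ⟨w, hw, by_contra fun hc => hy w hw hc hyw, hyw⟩

/-- The sides of the initial triangle are contained in the gasket: bisecting a side towards the
end nearer to a given point produces vertices that converge to this point. -/
lemma side_subset_gasket (ha : ∀ i j, i ≠ j → dist (a i) (a j) = 1) (i j : Fin 3) {t : ℝ}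
    (ht : t ∈ Icc (0 : ℝ) 1) : a i + t • (a j - a i) ∈ gasket a := by
  have key : ∀ n : ℕ, ∀ t ∈ Icc (0 : ℝ) 1,
      ∃ v ∈ vertices a n, dist (a i + t • (a j - a i)) v ≤ 1 / 2 ^ n := by
    intro n
    induction n with
    | zero =>
      intro t ht
      refine ⟨a i, corner_mem_vertices 0 i, ?_⟩
      rw [dist_eq_norm, add_sub_cancel_left, norm_smul, Real.norm_eq_abs, abs_of_nonneg ht.1]
      simpa using mul_le_one₀ ht.2 (norm_nonneg _) (norm_corner_sub_le ha i j)
    | succ n ih =>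
      intro t ht
      -- one step: pull the point back by the contraction towards the nearer end
      have step : ∀ (k : Fin 3) (s : ℝ), s ∈ Icc (0 : ℝ) 1 →
          contraction (a k) (a i + s • (a j - a i)) = a i + t • (a j - a i) →
          ∃ v ∈ vertices a (n + 1), dist (a i + t • (a j - a i)) v ≤ 1 / 2 ^ (n + 1) := by
        intro k s hs hk
        obtain ⟨v, ⟨w, hw, y, hy, rfl⟩, hv⟩ := ih s hs
        refine ⟨_, ⟨k :: w, by simp [hw], y, hy, rfl⟩, ?_⟩
        rw [cellMap_cons, ← hk, dist_contraction, pow_succ, ← div_div]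
        gcongr
      rcases le_total t (1 / 2) with h | h
      · refine step i (2 * t) ⟨by linarith [ht.1], by linarith⟩ ?_
        simp only [contraction]; module
      · refine step j (2 * t - 1) ⟨by linarith, by linarith [ht.2]⟩ ?_
        simp only [contraction]; module
  refine Metric.mem_closure_iff.2 fun ε hε => ?_
  obtain ⟨n, hn⟩ := exists_pow_lt_of_lt_one hε (by norm_num : (1 / 2 : ℝ) < 1)
  obtain ⟨v, hv, hd⟩ := key n t ht
  refine ⟨v, mem_iUnion.2 ⟨n, hv⟩, hd.trans_lt ?_⟩
  rwa [one_div_pow] at hn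

/-! ### Edges -/

lemma edgeLength_pos (n : ℕ) : 0 < edgeLength n := by unfold edgeLength; positivity

lemma Adj.symm {n : ℕ} {x y : Plane} (h : Adj a n x y) : Adj a n y x := by
  obtain ⟨w, hw, i, j, hij, rfl, rfl⟩ := h
  exact ⟨w, hw, j, i, hij.symm, rfl, rfl⟩

lemma Adj.left_mem {n : ℕ} {x y : Plane} (h : Adj a n x y) : x ∈ vertices a n := by
  obtain ⟨w, hw, i, j, hij, rfl, rfl⟩ := h
  exact ⟨w, hw, a i, ⟨i, rfl⟩, rfl⟩

lemma Adj.dist_eq (ha : ∀ i j, i ≠ j → dist (a i) (a j) = 1) {n : ℕ} {x y : Plane}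
    (h : Adj a n x y) : dist x y = edgeLength n := by
  obtain ⟨w, hw, i, j, hij, rfl, rfl⟩ := h
  rw [dist_cellMap, ha i j hij, hw, edgeLength]

lemma Adj.ne (ha : ∀ i j, i ≠ j → dist (a i) (a j) = 1) {n : ℕ} {x y : Plane}
    (h : Adj a n x y) : x ≠ y :=
  dist_pos.1 (h.dist_eq ha ▸ edgeLength_pos n)

@[simp] lemma edgeParam_zero (n : ℕ) (x y : Plane) : edgeParam n x y 0 = x := by simp [edgeParam]

@[simp] lemma edgeParam_edgeLength (n : ℕ) (x y : Plane) :
    edgeParam n x y (edgeLength n) = y := by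
  simp [edgeParam, div_self (edgeLength_pos n).ne']

lemma edgeParam_symm (n : ℕ) (x y : Plane) (t : ℝ) :
    edgeParam n y x t = edgeParam n x y (edgeLength n - t) := by
  have := (edgeLength_pos n).ne'
  simp only [edgeParam, sub_div, div_self this]
  module

lemma dist_edgeParam (ha : ∀ i j, i ≠ j → dist (a i) (a j) = 1) {n : ℕ} {x y : Plane}
    (h : Adj a n x y) (s t : ℝ) : dist (edgeParam n x y s) (edgeParam n x y t) = |s - t| := by
  have h1 : edgeParam n x y s - edgeParam n x y t = ((s - t) / edgeLength n) • (y - x) := by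
    simp only [edgeParam, sub_div]; module
  rw [dist_eq_norm, h1, norm_smul, ← dist_eq_norm, dist_comm, h.dist_eq ha, norm_div,
    Real.norm_eq_abs, Real.norm_eq_abs, abs_of_pos (edgeLength_pos n),
    div_mul_cancel₀ _ (edgeLength_pos n).ne']

lemma continuous_edgeParam (n : ℕ) (x y : Plane) : Continuous (edgeParam n x y) := by
  unfold edgeParam; fun_prop

lemma segment_eq_image_edgeParam (n : ℕ) (x y : Plane) :
    segment ℝ x y = edgeParam n x y '' Icc 0 (edgeLength n) := by
  have hh := edgeLength_pos n
  rw [segment_eq_image']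
  ext z
  constructor
  · rintro ⟨t, ht, rfl⟩
    refine ⟨t * edgeLength n, ⟨by have := ht.1; positivity, by nlinarith [ht.2]⟩, ?_⟩
    simp [edgeParam, hh.ne']
  · rintro ⟨t, ht, rfl⟩
    exact ⟨t / edgeLength n, ⟨div_nonneg ht.1 hh.le, (div_le_one hh).2 ht.2⟩, rfl⟩

lemma edgeParam_mem_prefractal {n : ℕ} {x y : Plane} (h : Adj a n x y) {t : ℝ}
    (ht : t ∈ Icc 0 (edgeLength n)) : edgeParam n x y t ∈ prefractal a n :=
  Or.inr ⟨x, y, h, segment_eq_image_edgeParam n x y ▸ ⟨t, ht, rfl⟩⟩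

lemma exists_adj {n : ℕ} {x : Plane} (hx : x ∈ vertices a n) : ∃ y, Adj a n x y := by
  obtain ⟨w, hw, _, ⟨i, rfl⟩, rfl⟩ := hx
  obtain ⟨j, hj⟩ : ∃ j : Fin 3, i ≠ j := by fin_cases i <;> decide
  exact ⟨_, w, hw, i, j, hj, rfl, rfl⟩

lemma exists_adj_ne (ha : ∀ i j, i ≠ j → dist (a i) (a j) = 1) {n : ℕ} {x y : Plane}
    (h : Adj a n x y) : ∃ z, Adj a n x z ∧ z ≠ y := by
  obtain ⟨w, hw, i, j, hij, rfl, rfl⟩ := h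
  obtain ⟨k, hk, hkj⟩ : ∃ k : Fin 3, i ≠ k ∧ k ≠ j := by
    fin_cases i <;> fin_cases j <;> first | exact absurd rfl hij | decide
  refine ⟨_, ⟨w, hw, i, k, hk, rfl, rfl⟩, fun h => ?_⟩
  have := ha k j hkj
  rw [cellMap_injective w h, dist_self] at this
  exact zero_ne_one this

/-- The network is the union of its edges. -/
lemma mem_prefractal_iff {n : ℕ} {z : Plane} :
    z ∈ prefractal a n ↔
      ∃ x y, Adj a n x y ∧ ∃ t ∈ Icc 0 (edgeLength n), edgeParam n x y t = z := by
  constructor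
  · rintro (h | ⟨x, y, h, hz⟩)
    · obtain ⟨y, hy⟩ := exists_adj h
      exact ⟨z, y, hy, 0, ⟨le_rfl, (edgeLength_pos n).le⟩, edgeParam_zero _ _ _⟩
    · rw [segment_eq_image_edgeParam n] at hz
      exact ⟨x, y, h, hz⟩
  · rintro ⟨x, y, h, t, ht, rfl⟩
    exact edgeParam_mem_prefractal h ht

lemma edgeParam_cellMap (n : ℕ) (w : List (Fin 3)) (i j : Fin 3) (t : ℝ) :
    edgeParam n (cellMap a w (a i)) (cellMap a w (a j)) t =
      cellMap a w (a i + (t / edgeLength n) • (a j - a i)) :=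
  (cellMap_lineMap w _ _ _).symm

lemma edgeParam_mem_gasket (ha : ∀ i j, i ≠ j → dist (a i) (a j) = 1) {n : ℕ} {x y : Plane}
    (h : Adj a n x y) {t : ℝ} (ht : t ∈ Icc 0 (edgeLength n)) :
    edgeParam n x y t ∈ gasket a := by
  have hh := edgeLength_pos n
  obtain ⟨w, hw, i, j, hij, rfl, rfl⟩ := h
  rw [edgeParam_cellMap]
  exact cellMap_mem_gasket w (side_subset_gasket ha i j
    ⟨div_nonneg ht.1 hh.le, (div_le_one hh).2 ht.2⟩)

lemma prefractal_subset_gasket (ha : ∀ i j, i ≠ j → dist (a i) (a j) = 1) (n : ℕ) :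
    prefractal a n ⊆ gasket a := fun z hz => by
  obtain ⟨x, y, h, t, ht, rfl⟩ := mem_prefractal_iff.1 hz
  exact edgeParam_mem_gasket ha h ht

lemma side_sum_smul (i j : Fin 3) (s : ℝ) :
    a i + s • (a j - a i) =
      ∑ l, ((1 - s) * (Pi.single i (1 : ℝ) : Fin 3 → ℝ) l +
        s * (Pi.single j (1 : ℝ) : Fin 3 → ℝ) l) • a l := by
  simp only [add_smul, mul_smul, Finset.sum_add_distrib, ← Finset.smul_sum, single_sum_smul]
  module

/-- An interior point of a side determines the side and the parameter, up to reversal. -/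
lemma side_injective (ha : ∀ i j, i ≠ j → dist (a i) (a j) = 1) {i j i' j' : Fin 3}
    (hij : i ≠ j) (hij' : i' ≠ j') {s s' : ℝ} (hs : s ∈ Ioo (0 : ℝ) 1)
    (h : a i + s • (a j - a i) = a i' + s' • (a j' - a i')) :
    i' = i ∧ j' = j ∧ s' = s ∨ i' = j ∧ j' = i ∧ s' = 1 - s := by
  rw [side_sum_smul, side_sum_smul] at h
  have := weights_unique ha (by simp [Finset.sum_add_distrib, ← Finset.mul_sum]) h
  have h1 := congrFun this i
  have h2 := congrFun this j
  obtain ⟨hs0, hs1⟩ := hs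
  simp only [Pi.single_apply, hij, hij.symm, if_true, if_false] at h1 h2
  by_cases e1 : i = i' <;> by_cases e2 : i = j' <;> by_cases e3 : j = i' <;>
    by_cases e4 : j = j' <;> (simp_all; try linarith)

/-- A relative interior point of an edge lies on no other edge. -/
lemma edgeParam_injective (ha : ∀ i j, i ≠ j → dist (a i) (a j) = 1) {n : ℕ}
    {x y x' y' : Plane} (h : Adj a n x y) (h' : Adj a n x' y') {t t' : ℝ}
    (ht : t ∈ Ioo 0 (edgeLength n)) (ht' : t' ∈ Icc 0 (edgeLength n))
    (heq : edgeParam n x y t = edgeParam n x' y' t') :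
    x' = x ∧ y' = y ∧ t' = t ∨ x' = y ∧ y' = x ∧ t' = edgeLength n - t := by
  have hh := edgeLength_pos n
  obtain ⟨w, hw, i, j, hij, rfl, rfl⟩ := h
  obtain ⟨w', hw', i', j', hij', rfl, rfl⟩ := h'
  have hs : t / edgeLength n ∈ Ioo (0 : ℝ) 1 := ⟨div_pos ht.1 hh, (div_lt_one hh).2 ht.2⟩
  have hs' : t' / edgeLength n ∈ Icc (0 : ℝ) 1 :=
    ⟨div_nonneg ht'.1 hh.le, (div_le_one hh).2 ht'.2⟩
  rw [edgeParam_cellMap, edgeParam_cellMap] at heq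
  have hmem := side_subset_gasket ha i' j' hs'
  rcases cells_inter ha (hw.trans hw'.symm) (side_subset_gasket ha i j (Ioo_subset_Icc_self hs))
    hmem heq with hE | ⟨⟨k, hk⟩, -⟩
  · rw [← hE hmem] at heq
    rw [← hE (corner_mem_gasket i'), ← hE (corner_mem_gasket j')]
    rcases side_injective ha hij hij' hs (cellMap_injective w heq) with
      ⟨rfl, rfl, h3⟩ | ⟨rfl, rfl, h3⟩
    · exact Or.inl ⟨rfl, rfl, by field_simp at h3; exact h3⟩
    · exact Or.inr ⟨rfl, rfl, by field_simp at h3; exact h3⟩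
  · exfalso
    obtain ⟨l, hl⟩ : ∃ l : Fin 3, k ≠ l := by fin_cases k <;> decide
    have hk' : a i + (t / edgeLength n) • (a j - a i) = a k + (0 : ℝ) • (a l - a k) := by
      rw [hk]; simp
    rcases side_injective ha hij hl hs hk' with ⟨-, -, h3⟩ | ⟨-, -, h3⟩
    · exact hs.1.ne h3
    · linarith [hs.2]

/-- A relative interior point of an edge is not a vertex. -/
lemma edgeParam_notMem_vertices (ha : ∀ i j, i ≠ j → dist (a i) (a j) = 1) {n : ℕ}
    {x y : Plane} (h : Adj a n x y) {t : ℝ} (ht : t ∈ Ioo 0 (edgeLength n)) :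
    edgeParam n x y t ∉ vertices a n := fun hv => by
  obtain ⟨z, hz⟩ := exists_adj hv
  rcases edgeParam_injective ha h hz ht ⟨le_rfl, (edgeLength_pos n).le⟩
    (edgeParam_zero _ _ _).symm with ⟨-, -, h3⟩ | ⟨-, -, h3⟩
  · exact ht.1.ne h3
  · linarith [ht.2]

/-! ### Lipschitz curves in the gasket -/

/-- The curves in the gasket, parametrized over the whole line, that are `1`-Lipschitz for the
Euclidean distance. -/
def IsLipCurve (a : Fin 3 → Plane) (ξ : ℝ → Plane) : Prop :=
  LipschitzWith 1 ξ ∧ ∀ t, ξ t ∈ gasket a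

lemma lipschitzWith_one_iff {ξ : ℝ → Plane} :
    LipschitzWith 1 ξ ↔ ∀ s t, dist (ξ s) (ξ t) ≤ |s - t| := by
  simp [lipschitzWith_iff_dist_le_mul, Real.dist_eq]

lemma IsLipCurve.continuous {ξ : ℝ → Plane} (h : IsLipCurve a ξ) : Continuous ξ := h.1.continuous

lemma isLipCurve_const {x : Plane} (hx : x ∈ gasket a) : IsLipCurve a fun _ => x :=
  ⟨LipschitzWith.const' x, fun _ => hx⟩

lemma IsLipCurve.comp {ξ : ℝ → Plane} (h : IsLipCurve a ξ) {φ : ℝ → ℝ}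
    (hφ : LipschitzWith 1 φ) : IsLipCurve a (ξ ∘ φ) :=
  ⟨by simpa using h.1.comp hφ, fun t => h.2 _⟩

lemma IsLipCurve.comp_add {ξ : ℝ → Plane} (h : IsLipCurve a ξ) (c : ℝ) :
    IsLipCurve a fun t => ξ (t + c) :=
  h.comp (φ := fun t => t + c) (LipschitzWith.of_dist_le_mul fun s t => by simp)

lemma IsLipCurve.comp_sub_left {ξ : ℝ → Plane} (h : IsLipCurve a ξ) (c : ℝ) :
    IsLipCurve a fun t => ξ (c - t) :=
  h.comp (φ := fun t => c - t) (LipschitzWith.of_dist_le_mul fun s t => by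
    rw [Real.dist_eq, Real.dist_eq, sub_sub_sub_cancel_left, abs_sub_comm]; simp)

lemma IsLipCurve.concat {ξ η : ℝ → Plane} (hξ : IsLipCurve a ξ) (hη : IsLipCurve a η) {T : ℝ}
    (h : ξ T = η 0) : IsLipCurve a fun t => if t ≤ T then ξ t else η (t - T) := by
  refine ⟨lipschitzWith_one_iff.2 ?_, fun t => by
    dsimp only; split_ifs; exacts [hξ.2 _, hη.2 _]⟩
  have hξ' := lipschitzWith_one_iff.1 hξ.1
  have hη' := lipschitzWith_one_iff.1 hη.1
  have key : ∀ s t, s ≤ T → T < t → dist (ξ s) (η (t - T)) ≤ t - s := fun s t hs ht => by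
    refine (dist_triangle _ (ξ T) _).trans ?_
    have h1 := hξ' s T
    have h2 := hη' 0 (t - T)
    rw [abs_of_nonpos (by linarith)] at h1 h2
    rw [← h] at h2
    linarith
  intro s t
  by_cases hs : s ≤ T <;> by_cases ht : t ≤ T <;> simp only [hs, ht, if_true, if_false]
  · exact hξ' s t
  · rw [abs_of_nonpos (by linarith)]; linarith [key s t hs (not_le.1 ht)]
  · rw [dist_comm, abs_of_nonneg (by linarith)]; exact key t s ht (not_le.1 hs)
  · simpa using hη' (s - T) (t - T)

/-- A curve over a compact interval is extended by its end values. -/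
lemma exists_isLipCurve_eqOn {ξ : ℝ → Plane} {s t : ℝ} (hst : s ≤ t)
    (hL : ∀ r ∈ Icc s t, ∀ r' ∈ Icc s t, dist (ξ r) (ξ r') ≤ |r - r'|)
    (hS : MapsTo ξ (Icc s t) (gasket a)) : ∃ η, IsLipCurve a η ∧ EqOn η ξ (Icc s t) := by
  refine ⟨fun r => ξ (projIcc s t hst r), ⟨lipschitzWith_one_iff.2 fun r r' => ?_, fun r => ?_⟩,
    fun r hr => ?_⟩
  · refine (hL _ (projIcc s t hst r).2 _ (projIcc s t hst r').2).trans ?_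
    have := (LipschitzWith.projIcc hst).dist_le_mul r r'
    simpa [Subtype.dist_eq, Real.dist_eq] using this
  · exact hS (projIcc s t hst r).2
  · dsimp only; rw [projIcc_of_mem hst hr]

lemma exists_isLipCurve_edge (ha : ∀ i j, i ≠ j → dist (a i) (a j) = 1) {n : ℕ} {x y : Plane}
    (h : Adj a n x y) :
    ∃ η, IsLipCurve a η ∧ EqOn η (edgeParam n x y) (Icc 0 (edgeLength n)) :=
  exists_isLipCurve_eqOn (edgeLength_pos n).le (fun r _ r' _ => (dist_edgeParam ha h r r').le)
    fun _ ht => edgeParam_mem_gasket ha h ht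

/-- The points joined to a corner by a curve of length at most one form a compact set, by
Tychonoff's theorem: the curves form a closed set for pointwise convergence. -/
lemma isCompact_joined_corner :
    IsCompact {x | ∃ ξ, IsLipCurve a ξ ∧ ξ 0 = x ∧ ξ 1 ∈ corners a} := by
  have h1 : IsCompact {ξ : ℝ → Plane | ∀ t, ξ t ∈ gasket a} := isCompact_pi_infinite fun _ =>
    isCompact_gasket
  have h2 : IsClosed {ξ : ℝ → Plane | ∀ s t, dist (ξ s) (ξ t) ≤ |s - t|} := by
    simp only [ofPred_forall]
    exact isClosed_iInter fun s => isClosed_iInter fun t => isClosed_le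
      ((continuous_apply s).dist (continuous_apply t)) continuous_const
  have h3 : IsClosed {ξ : ℝ → Plane | ξ 1 ∈ corners a} :=
    (finite_range a).isClosed.preimage (continuous_apply 1)
  convert ((h1.inter_right h2).inter_right h3).image (continuous_apply (0 : ℝ)) using 1
  ext x
  simp only [IsLipCurve, lipschitzWith_one_iff, mem_ofPred_eq, mem_image, mem_inter_iff]
  constructor
  · rintro ⟨ξ, ⟨h, h'⟩, h4, h5⟩
    exact ⟨ξ, ⟨⟨h', h⟩, h5⟩, h4⟩
  · rintro ⟨ξ, ⟨⟨h', h⟩, h5⟩, h4⟩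
    exact ⟨ξ, ⟨h, h'⟩, h4, h5⟩

/-- The image of a curve under a cell map, run at the original speed. -/
lemma IsLipCurve.comp_cellMap {ξ : ℝ → Plane} (hξ : IsLipCurve a ξ) (w : List (Fin 3)) :
    IsLipCurve a fun t => cellMap a w (ξ (2 ^ w.length * t)) := by
  refine ⟨lipschitzWith_one_iff.2 fun s t => ?_, fun t => cellMap_mem_gasket w (hξ.2 _)⟩
  rw [dist_cellMap, div_le_iff₀ (by positivity)]
  refine (lipschitzWith_one_iff.1 hξ.1 _ _).trans ?_
  rw [← mul_sub, abs_mul, abs_of_pos (by positivity), mul_comm]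

/-- Every point of the gasket is joined to a corner by a curve of length at most one. -/
lemma exists_isLipCurve_corner (ha : ∀ i j, i ≠ j → dist (a i) (a j) = 1) {x : Plane}
    (hx : x ∈ gasket a) : ∃ ξ, IsLipCurve a ξ ∧ ξ 0 = x ∧ ξ 1 ∈ corners a := by
  refine closure_minimal (iUnion_subset fun n => ?_) isCompact_joined_corner.isClosed hx
  rintro _ ⟨w, -, _, ⟨i, rfl⟩, rfl⟩
  clear n
  induction w with
  | nil => exact ⟨_, isLipCurve_const (corner_mem_gasket i), rfl, i, rfl⟩
  | cons j w ih =>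
    obtain ⟨ξ, hξ, h0, k, hk⟩ := ih
    have h1 := hξ.comp_cellMap [j]
    simp only [List.length_singleton, pow_one] at h1
    -- the second half of the curve runs from the corner `k` of the subcell to the corner `j`
    obtain ⟨η, hη, hηe⟩ : ∃ η, IsLipCurve a η ∧
        EqOn η (fun t => cellMap a [j] (a k + (2 * t) • (a j - a k)))
          (Icc 0 (1 / 2)) := by
      refine exists_isLipCurve_eqOn (by norm_num) (fun r _ r' _ => ?_) fun r hr =>
        cellMap_mem_gasket _ (side_subset_gasket ha k j ⟨by linarith [hr.1], by linarith [hr.2]⟩)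
      have hkj := norm_corner_sub_le ha k j
      have h2 : a k + (2 * r) • (a j - a k) - (a k + (2 * r') • (a j - a k)) =
          (2 * (r - r')) • (a j - a k) := by module
      rw [dist_cellMap, dist_eq_norm, h2, norm_smul, Real.norm_eq_abs, abs_mul]
      norm_num
      nlinarith [abs_nonneg (r - r')]
    refine ⟨_, h1.concat (T := 1 / 2) hη ?_, ?_, j, ?_⟩
    · rw [hηe ⟨le_rfl, by norm_num⟩]
      simp [hk]
    · simp [h0, cellMap]
    · norm_num
      rw [hηe ⟨by norm_num, by norm_num⟩]
      norm_num [cellMap, contraction_self]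

/-- Two points of a common cell of level `n` are joined by a curve of length at most
`3 * 2 ^ (-n)`. -/
lemma exists_isLipCurve_cell (ha : ∀ i j, i ≠ j → dist (a i) (a j) = 1) {w : List (Fin 3)}
    {x y : Plane} (hx : x ∈ cellMap a w '' gasket a) (hy : y ∈ cellMap a w '' gasket a) :
    ∃ ξ, IsLipCurve a ξ ∧ ξ 0 = x ∧ ξ (3 * edgeLength w.length) = y := by
  obtain ⟨x, hx, rfl⟩ := hx
  obtain ⟨y, hy, rfl⟩ := hy
  obtain ⟨ξ, hξ, hξ0, i, hi⟩ := exists_isLipCurve_corner ha hx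
  obtain ⟨η, hη, hη0, j, hj⟩ := exists_isLipCurve_corner ha hy
  obtain ⟨ζ, hζ, hζe⟩ : ∃ ζ, IsLipCurve a ζ ∧
      EqOn ζ (fun t => a i + t • (a j - a i)) (Icc 0 1) := by
    refine exists_isLipCurve_eqOn zero_le_one (fun r _ r' _ => ?_) fun r hr =>
      side_subset_gasket ha i j hr
    have hij := norm_corner_sub_le ha i j
    have h2 : a i + r • (a j - a i) - (a i + r' • (a j - a i)) = (r - r') • (a j - a i) := by
      module
    rw [dist_eq_norm, h2, norm_smul, Real.norm_eq_abs]
    nlinarith [abs_nonneg (r - r')]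
  have h1 := hξ.concat hζ (T := 1) (by rw [hζe ⟨le_rfl, zero_le_one⟩]; simp [hi])
  have h2 := h1.concat (hη.comp_sub_left 1) (T := 2) (by
    norm_num
    rw [hζe ⟨zero_le_one, le_rfl⟩]; simp [hj])
  refine ⟨_, h2.comp_cellMap w, by norm_num [hξ0], ?_⟩
  have h3 : (2 : ℝ) ^ w.length * (3 * edgeLength w.length) = 3 := by
    unfold edgeLength; field_simp
  simp only [h3]
  norm_num [hη0]

lemma exists_isLipCurve (ha : ∀ i j, i ≠ j → dist (a i) (a j) = 1) {x y : Plane}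
    (hx : x ∈ gasket a) (hy : y ∈ gasket a) : ∃ ξ, IsLipCurve a ξ ∧ ξ 0 = x ∧ ξ 3 = y := by
  have := exists_isLipCurve_cell ha (w := []) ⟨x, hx, rfl⟩ ⟨y, hy, rfl⟩
  simpa [edgeLength, cellMap] using this

/-! ### The geodesic distance and unit curves -/

lemma intervalIntegrable_norm_deriv {ξ : ℝ → Plane} (h : LipschitzWith 1 ξ) (s t : ℝ) :
    IntervalIntegrable (fun r => ‖deriv ξ r‖) volume s t := by
  refine (intervalIntegrable_const (c := (1 : ℝ))).mono_fun
    (measurable_deriv ξ).norm.aestronglyMeasurable (Eventually.of_forall fun r => ?_)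
  simpa using norm_deriv_le_of_lipschitz h

lemma dist_le_integral_norm_deriv {ξ : ℝ → Plane} (h : LipschitzWith 1 ξ) {s t : ℝ}
    (hst : s ≤ t) : dist (ξ s) (ξ t) ≤ ∫ r in s..t, ‖deriv ξ r‖ := by
  set v := ξ t - ξ s with hv
  set g : ℝ → ℝ := fun r => inner ℝ v (ξ r) with hg
  have hgL : LipschitzWith ‖v‖₊ g := LipschitzWith.of_dist_le_mul fun r r' => by
    rw [Real.dist_eq, hg, ← inner_sub_right]
    refine (abs_real_inner_le_norm _ _).trans ?_
    rw [coe_nnnorm]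
    gcongr
    simpa [dist_eq_norm] using h.dist_le_mul r r'
  have h1 := (hgL.lipschitzOnWith (s := uIcc s t)).absolutelyContinuousOnInterval
  have h2 := h1.integral_deriv_eq_sub
  have h3 : ∫ r in s..t, deriv g r ≤ ∫ r in s..t, ‖v‖ * ‖deriv ξ r‖ := by
    refine intervalIntegral.integral_mono_ae hst h1.intervalIntegrable_deriv
      ((intervalIntegrable_norm_deriv h s t).const_mul _) ?_
    filter_upwards [h.ae_differentiableAt_real] with r hr
    have : HasDerivAt g (inner ℝ v (deriv ξ r)) r := by
      simpa using (hasDerivAt_const r v).inner ℝ hr.hasDerivAt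
    rw [this.deriv]
    exact real_inner_le_norm _ _
  rw [intervalIntegral.integral_const_mul, h2] at h3
  have h4 : g t - g s = ‖v‖ * ‖v‖ := by
    rw [hg, ← inner_sub_right, ← hv, real_inner_self_eq_norm_mul_norm]
  rw [h4] at h3
  rw [dist_comm, dist_eq_norm, ← hv]
  rcases (norm_nonneg v).eq_or_lt with h0 | h0
  · rw [← h0]; exact intervalIntegral.integral_nonneg hst fun _ _ => norm_nonneg _
  · exact le_of_mul_le_mul_left h3 h0

lemma eVariationOn_le_integral_norm_deriv {ξ : ℝ → Plane} (h : LipschitzWith 1 ξ) {s t : ℝ}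
    (hst : s ≤ t) :
    eVariationOn ξ (Icc s t) ≤ ENNReal.ofReal (∫ r in s..t, ‖deriv ξ r‖) := by
  set Λ : ℝ → ℝ := fun r => ∫ r' in s..r, ‖deriv ξ r'‖ with hΛ
  have hsub : ∀ r r', Λ r' - Λ r = ∫ q in r..r', ‖deriv ξ q‖ := fun r r' =>
    intervalIntegral.integral_interval_sub_left (intervalIntegrable_norm_deriv h _ _)
      (intervalIntegrable_norm_deriv h _ _)
  have hmono : Monotone Λ := fun r r' hr => by
    rw [← sub_nonneg, hsub]
    exact intervalIntegral.integral_nonneg hr fun _ _ => norm_nonneg _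
  have h1 : eVariationOn ξ (Icc s t) ≤ eVariationOn Λ (Icc s t) := by
    refine iSup_mono fun p => Finset.sum_le_sum fun i _ => ?_
    have hp := p.2.2.1 (Nat.le_succ i)
    rw [edist_dist, edist_dist]
    refine ENNReal.ofReal_le_ofReal ?_
    rw [dist_comm, Real.dist_eq, abs_of_nonneg (sub_nonneg.2 (hmono hp)), hsub]
    exact dist_le_integral_norm_deriv h hp
  refine h1.trans ?_
  have h2 := (hmono.monotoneOn (Icc s t)).eVariationOn_eq (left_mem_Icc.2 hst)
    (right_mem_Icc.2 hst)
  rw [inter_self] at h2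
  simpa [hΛ] using h2.le

lemma iInf_eVariationOn_le {ξ : ℝ → Plane} (h : IsLipCurve a ξ) (s t : ℝ) :
    ⨅ γ ∈ paths a (ξ s) (ξ t), eVariationOn γ (Icc (0 : ℝ) 1) ≤
      ENNReal.ofReal |∫ r in s..t, ‖deriv ξ r‖| := by
  refine (iInf₂_le (fun r => ξ (s + r * (t - s)))
    ⟨(h.continuous.comp (by fun_prop : Continuous fun r : ℝ => s + r * (t - s))).continuousOn,
      fun r _ => h.2 _, by simp, by simp⟩).trans ?_
  · rcases le_total s t with hst | hst
    · refine (eVariationOn.comp_le_of_monotoneOn ξ (s := Icc s t) (fun r => s + r * (t - s))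
        (fun r _ r' _ hr => ?_) fun r hr => ?_).trans ?_
      · have := sub_nonneg.2 hst; dsimp only; nlinarith
      · constructor <;> nlinarith [hr.1, hr.2]
      · rw [abs_of_nonneg (intervalIntegral.integral_nonneg hst fun _ _ => norm_nonneg _)]
        exact eVariationOn_le_integral_norm_deriv h.1 hst
    · refine (eVariationOn.comp_le_of_antitoneOn ξ (s := Icc t s) (fun r => s + r * (t - s))
        (fun r _ r' _ hr => ?_) fun r hr => ?_).trans ?_
      · dsimp only; nlinarith
      · constructor <;> nlinarith [hr.1, hr.2]
      · rw [intervalIntegral.integral_symm, abs_neg,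
          abs_of_nonneg (intervalIntegral.integral_nonneg hst fun _ _ => norm_nonneg _)]
        exact eVariationOn_le_integral_norm_deriv h.1 hst

lemma geoDist_le_integral_norm_deriv {ξ : ℝ → Plane} (h : IsLipCurve a ξ) (s t : ℝ) :
    geoDist a (ξ s) (ξ t) ≤ |∫ r in s..t, ‖deriv ξ r‖| :=
  ENNReal.toReal_le_of_le_ofReal (abs_nonneg _) (iInf_eVariationOn_le h s t)

/-- The geodesic distance dominates the Euclidean one. This uses that the infimum which defines
it is finite. -/
lemma dist_le_geoDist (ha : ∀ i j, i ≠ j → dist (a i) (a j) = 1) {x y : Plane}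
    (hx : x ∈ gasket a) (hy : y ∈ gasket a) : dist x y ≤ geoDist a x y := by
  obtain ⟨ξ, hξ, rfl, rfl⟩ := exists_isLipCurve ha hx hy
  rw [dist_edist, geoDist]
  refine ENNReal.toReal_mono ((iInf_eVariationOn_le hξ 0 3).trans_lt ENNReal.ofReal_lt_top).ne ?_
  refine le_iInf₂ fun γ hγ => ?_
  rw [← hγ.2.2.1, ← hγ.2.2.2]
  exact eVariationOn.edist_le γ (left_mem_Icc.2 zero_le_one) (right_mem_Icc.2 zero_le_one)

/-- A unit curve is `1`-Lipschitz for the Euclidean distance. -/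
lemma IsUnitCurve.dist_le (ha : ∀ i j, i ≠ j → dist (a i) (a j) = 1) {I : Set ℝ}
    (hI : I.OrdConnected) {Ω : Set Plane} (hΩ : Ω ⊆ gasket a) {ξ : ℝ → Plane}
    (h : IsUnitCurve a I Ω ξ) : ∀ s ∈ I, ∀ t ∈ I, dist (ξ s) (ξ t) ≤ |s - t| := by
  obtain ⟨hm, m, -, hloc, hle, h1⟩ := h
  have key : ∀ s ∈ I, ∀ t ∈ I, s ≤ t → dist (ξ s) (ξ t) ≤ t - s := by
    intro s hs t ht hst
    refine (dist_le_geoDist ha (hΩ (hm hs)) (hΩ (hm ht))).trans ((hle s hs t ht hst).trans ?_)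
    have hsub : Icc s t ⊆ I := hI.out hs ht
    have h2 : IntervalIntegrable m volume s t :=
      (intervalIntegrable_iff_integrableOn_Icc_of_le hst).2
        (hloc.integrableOn_compact_subset hsub isCompact_Icc)
    have h3 : ∫ r in s..t, m r ≤ ∫ _ in s..t, (1 : ℝ) :=
      intervalIntegral.integral_mono_ae_restrict hst h2 intervalIntegrable_const
        (ae_restrict_of_ae_restrict_of_subset hsub h1)
    simpa using h3
  intro s hs t ht
  rcases le_total s t with hst | hst
  · rw [abs_of_nonpos (by linarith)]; linarith [key s hs t ht hst]
  · rw [dist_comm, abs_of_nonneg (by linarith)]; exact key t ht s hs hst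

/-- A Euclidean `1`-Lipschitz curve in the gasket is a unit curve: by Rademacher's theorem and
Lebesgue's differentiation theorem, the norm of its derivative is its metric derivative for the
geodesic distance, since this distance is squeezed between the Euclidean one and the length. -/
lemma IsLipCurve.isUnitCurve (ha : ∀ i j, i ≠ j → dist (a i) (a j) = 1) {ξ : ℝ → Plane}
    (h : IsLipCurve a ξ) {I : Set ℝ} {Ω : Set Plane} (hΩ : MapsTo ξ I Ω) :
    IsUnitCurve a I Ω ξ := by
  have hint : LocallyIntegrable (fun r => ‖deriv ξ r‖) volume := by
    refine (locallyIntegrable_const (1 : ℝ)).mono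
      (measurable_deriv ξ).norm.aestronglyMeasurable (Eventually.of_forall fun r => ?_)
    simpa using norm_deriv_le_of_lipschitz h.1
  refine ⟨hΩ, fun r => ‖deriv ξ r‖, ?_, hint.locallyIntegrableOn I, fun s _ t _ hst => ?_, ?_⟩
  · refine ae_restrict_of_ae ?_
    filter_upwards [h.1.ae_differentiableAt_real,
      LocallyIntegrable.ae_hasDerivAt_integral hint] with t ht1 ht2
    have hmono : 𝓝[I \ {t}] t ≤ 𝓝[≠] t := nhdsWithin_mono _ fun s hs => hs.2
    refine Tendsto.mono_left ?_ hmono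
    have lo : Tendsto (fun s => dist (ξ s) (ξ t) / |s - t|) (𝓝[≠] t) (𝓝 ‖deriv ξ t‖) := by
      refine ht1.hasDerivAt.tendsto_slope.norm.congr fun s => ?_
      rw [slope_def_module, norm_smul, norm_inv, Real.norm_eq_abs, dist_eq_norm]
      ring
    have hi : Tendsto (fun s => |∫ r in s..t, ‖deriv ξ r‖| / |s - t|) (𝓝[≠] t)
        (𝓝 ‖deriv ξ t‖) := by
      have := ((ht2 t).tendsto_slope.norm)
      rw [norm_norm] at this
      refine this.congr fun s => ?_
      rw [slope_def_module, norm_smul, norm_inv, Real.norm_eq_abs, Real.norm_eq_abs,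
        intervalIntegral.integral_same, sub_zero, intervalIntegral.integral_symm, abs_neg]
      ring
    refine tendsto_of_tendsto_of_tendsto_of_le_of_le lo hi (fun s => ?_) fun s => ?_
    · dsimp only; gcongr; exact dist_le_geoDist ha (h.2 s) (h.2 t)
    · dsimp only; gcongr; exact geoDist_le_integral_norm_deriv h s t
  · refine (geoDist_le_integral_norm_deriv h s t).trans (abs_of_nonneg ?_).le
    exact intervalIntegral.integral_nonneg hst fun _ _ => norm_nonneg _
  · exact Eventually.of_forall fun r => by simpa using norm_deriv_le_of_lipschitz h.1

variable {f : Plane → ℝ} {g : Fin 3 → ℝ}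

/-! ### The value function on the gasket -/

/-- The standing assumptions: an equilateral triangle of side one, a continuous positive cost on
the gasket, compatible boundary data. -/
structure EikonalData (a : Fin 3 → Plane) (f : Plane → ℝ) (g : Fin 3 → ℝ) : Prop where
  side : ∀ i j, i ≠ j → dist (a i) (a j) = 1
  cont : ContinuousOn f (gasket a)
  pos : ∃ c > 0, ∀ x ∈ gasket a, c ≤ f x
  compat : Compatible a f g

/-- The costs of the Lipschitz curves that lead from `x` to a corner, including the boundary
value paid there. -/
def costs (a : Fin 3 → Plane) (f : Plane → ℝ) (g : Fin 3 → ℝ) (x : Plane) : Set ℝ :=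
  {c | ∃ (ξ : ℝ → Plane) (T : ℝ) (j : Fin 3), IsLipCurve a ξ ∧ 0 ≤ T ∧ ξ 0 = x ∧ ξ T = a j ∧
    c = (∫ t in (0 : ℝ)..T, f (ξ t)) + g j}

/-- The value function: the least cost of reaching a corner. -/
def value (a : Fin 3 → Plane) (f : Plane → ℝ) (g : Fin 3 → ℝ) (x : Plane) : ℝ :=
  sInf (costs a f g x)

lemma EikonalData.fpos (h : EikonalData a f g) {x : Plane} (hx : x ∈ gasket a) : 0 < f x := by
  obtain ⟨c, hc, hcf⟩ := h.pos
  exact hc.trans_le (hcf x hx)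

lemma EikonalData.continuous_comp (h : EikonalData a f g) {ξ : ℝ → Plane}
    (hξ : IsLipCurve a ξ) : Continuous fun t => f (ξ t) :=
  h.cont.comp_continuous hξ.continuous hξ.2

lemma EikonalData.intervalIntegrable (h : EikonalData a f g) {ξ : ℝ → Plane}
    (hξ : IsLipCurve a ξ) (s t : ℝ) : IntervalIntegrable (fun t => f (ξ t)) volume s t :=
  (h.continuous_comp hξ).intervalIntegrable _ _

lemma EikonalData.integral_nonneg (h : EikonalData a f g) {ξ : ℝ → Plane}
    (hξ : IsLipCurve a ξ) {s t : ℝ} (hst : s ≤ t) : 0 ≤ ∫ r in s..t, f (ξ r) :=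
  intervalIntegral.integral_nonneg hst fun r _ => (h.fpos (hξ.2 r)).le

lemma EikonalData.exists_bound (h : EikonalData a f g) : ∃ M > 0, ∀ x ∈ gasket a, f x ≤ M := by
  obtain ⟨M, hM⟩ := isCompact_gasket.exists_bound_of_continuousOn h.cont
  exact ⟨max M 1, by positivity, fun x hx =>
    ((le_abs_self _).trans (hM x hx)).trans (le_max_left _ _)⟩

lemma costs_nonempty (h : EikonalData a f g) {x : Plane} (hx : x ∈ gasket a) :
    (costs a f g x).Nonempty := by
  obtain ⟨ξ, hξ, h0, j, hj⟩ := exists_isLipCurve_corner h.side hx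
  exact ⟨_, ξ, 1, j, hξ, zero_le_one, h0, hj.symm, rfl⟩

lemma exists_le_boundary (g : Fin 3 → ℝ) : ∃ m, ∀ j, m ≤ g j := by
  obtain ⟨m, hm⟩ := (finite_range g).bddBelow
  exact ⟨m, fun j => hm ⟨j, rfl⟩⟩

lemma bddBelow_costs (h : EikonalData a f g) (x : Plane) : BddBelow (costs a f g x) := by
  obtain ⟨m, hm⟩ := exists_le_boundary g
  refine ⟨m, ?_⟩
  rintro _ ⟨ξ, T, j, hξ, hT, -, -, rfl⟩
  linarith [hm j, h.integral_nonneg hξ hT]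

lemma value_le (h : EikonalData a f g) {ξ : ℝ → Plane} (hξ : IsLipCurve a ξ) {T : ℝ}
    (hT : 0 ≤ T) {j : Fin 3} (hj : ξ T = a j) :
    value a f g (ξ 0) ≤ (∫ t in (0 : ℝ)..T, f (ξ t)) + g j :=
  csInf_le (bddBelow_costs h _) ⟨ξ, T, j, hξ, hT, rfl, hj, rfl⟩

/-- The dynamic programming inequality. -/
lemma value_le_integral_add (h : EikonalData a f g) {ξ : ℝ → Plane} (hξ : IsLipCurve a ξ)
    {s t : ℝ} (hst : s ≤ t) :
    value a f g (ξ s) ≤ (∫ r in s..t, f (ξ r)) + value a f g (ξ t) := by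
  rw [← sub_le_iff_le_add']
  refine le_csInf (costs_nonempty h (hξ.2 t)) ?_
  rintro _ ⟨η, T, j, hη, hT, h0, hTj, rfl⟩
  have hts : 0 ≤ t - s := sub_nonneg.2 hst
  have hc := (hξ.comp_add s).concat hη (T := t - s) (by simp [h0])
  have h1 := value_le h hc (T := t - s + T) (by positivity) (j := j) (by
    rcases hT.eq_or_lt with h' | h'
    · subst h'; simp [← hTj, h0]
    · simp [h', hTj])
  simp only [hts, if_true, zero_add] at h1
  have h2 : ∫ r in (0 : ℝ)..(t - s + T), f (if r ≤ t - s then ξ (r + s) else η (r - (t - s))) =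
      (∫ r in s..t, f (ξ r)) + ∫ r in (0 : ℝ)..T, f (η r) := by
    rw [← intervalIntegral.integral_add_adjacent_intervals (b := t - s)
      (h.intervalIntegrable hc _ _) (h.intervalIntegrable hc _ _)]
    congr 1
    · rw [intervalIntegral.integral_congr (g := fun r => f (ξ (r + s))) fun r hr => ?_]
      · rw [intervalIntegral.integral_comp_add_right (fun r => f (ξ r))]; simp
      · rw [uIcc_of_le hts] at hr
        simp only [hr.2, if_true]
    · rw [intervalIntegral.integral_congr (g := fun r => f (η (r - (t - s)))) fun r hr => ?_]
      · rw [intervalIntegral.integral_comp_sub_right (fun r => f (η r))]; simp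
      · rw [uIcc_of_le (by linarith)] at hr
        rcases hr.1.eq_or_lt with h' | h'
        · subst h'; simp [h0]
        · simp [not_le.2 h']
  rw [h2] at h1
  linarith

lemma abs_value_sub_le (h : EikonalData a f g) {ξ : ℝ → Plane} (hξ : IsLipCurve a ξ)
    {s t : ℝ} (hst : s ≤ t) :
    |value a f g (ξ s) - value a f g (ξ t)| ≤ ∫ r in s..t, f (ξ r) := by
  have h1 := value_le_integral_add h hξ hst
  have h2 := value_le_integral_add h (hξ.comp_sub_left (s + t)) hst
  rw [intervalIntegral.integral_comp_sub_left (fun r => f (ξ r))] at h2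
  simp only [add_sub_cancel_left, add_sub_cancel_right] at h2
  rw [abs_le]
  constructor <;> linarith

lemma corner_injective (ha : ∀ i j, i ≠ j → dist (a i) (a j) = 1) : Function.Injective a :=
  fun i j hij => by_contra fun h => by
    have := ha i j h
    rw [hij, dist_self] at this
    exact zero_ne_one this

/-- Compatibility says that the value function takes the boundary values. -/
lemma value_corner (h : EikonalData a f g) (i : Fin 3) : value a f g (a i) = g i := by
  refine le_antisymm ?_ (le_csInf (costs_nonempty h (corner_mem_gasket i)) ?_)
  · simpa using value_le h (isLipCurve_const (corner_mem_gasket i)) le_rfl (j := i) rfl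
  · rintro _ ⟨ξ, T, j, hξ, hT, h0, hj, rfl⟩
    rcases hT.eq_or_lt with rfl | hT
    · rw [h0] at hj
      simp [corner_injective h.side hj]
    · exact h.compat i j T ξ hT (hξ.isUnitCurve h.side fun t _ => hξ.2 t) h0 hj

lemma abs_value_sub_le_of_cell (h : EikonalData a f g) {M : ℝ}
    (hM : ∀ x ∈ gasket a, f x ≤ M) {w : List (Fin 3)} {x y : Plane}
    (hx : x ∈ cellMap a w '' gasket a) (hy : y ∈ cellMap a w '' gasket a) :
    |value a f g x - value a f g y| ≤ M * (3 * edgeLength w.length) := by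
  obtain ⟨ξ, hξ, rfl, rfl⟩ := exists_isLipCurve_cell h.side hx hy
  have h0 : 0 ≤ 3 * edgeLength w.length := by have := edgeLength_pos w.length; positivity
  refine (abs_value_sub_le h hξ h0).trans ?_
  have := intervalIntegral.integral_mono_on h0 (h.intervalIntegrable hξ _ _)
    (intervalIntegrable_const (c := M)) fun r _ => hM _ (hξ.2 r)
  simpa [mul_comm] using this

lemma exists_edgeLength_lt {ε : ℝ} (hε : 0 < ε) : ∃ N, ∀ n ≥ N, edgeLength n < ε := by
  obtain ⟨N, hN⟩ := exists_pow_lt_of_lt_one hε (by norm_num : (1 / 2 : ℝ) < 1)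
  refine ⟨N, fun n hn => lt_of_le_of_lt ?_ hN⟩
  rw [edgeLength, ← one_div_pow]
  exact pow_le_pow_of_le_one (by norm_num) (by norm_num) hn

lemma continuousOn_value (h : EikonalData a f g) : ContinuousOn (value a f g) (gasket a) := by
  obtain ⟨M, hM0, hM⟩ := h.exists_bound
  intro x _
  refine Metric.tendsto_nhds.2 fun ε hε => ?_
  obtain ⟨n, hn⟩ := exists_edgeLength_lt (show 0 < ε / (3 * M) by positivity)
  filter_upwards [eventually_common_cell n x] with y ⟨w, hw, hxw, hyw⟩
  refine (abs_value_sub_le_of_cell h hM hyw hxw).trans_lt ?_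
  have := hn n le_rfl
  rw [lt_div_iff₀ (by positivity)] at this
  rw [hw]
  linarith

/-! ### The value function is a metric viscosity solution -/

lemma abs_le_of_mem_superdiff {w : ℝ → ℝ} {t p L : ℝ} (hp : p ∈ superdiff w t)
    (h : ∀ ε > 0, ∀ᶠ s in 𝓝 t, w t - (L + ε) * |s - t| ≤ w s) : |p| ≤ L := by
  refine le_of_forall_pos_le_add fun ε hε => ?_
  obtain ⟨δ, hδ, hball⟩ := Metric.eventually_nhds_iff.1
    ((hp (ε / 2) (by positivity)).and (h (ε / 2) (by positivity)))
  have h1 := hball (y := t + δ / 2) (by simp [abs_of_pos hδ]; linarith)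
  have h2 := hball (y := t - δ / 2) (by simp [abs_of_pos hδ]; linarith)
  simp only [add_sub_cancel_left, sub_sub_cancel_left, abs_neg, abs_of_pos (half_pos hδ)] at h1 h2
  have h3 : 0 ≤ (L + ε + p) * (δ / 2) := by nlinarith [h1.1, h1.2]
  have h4 : 0 ≤ (L + ε - p) * (δ / 2) := by nlinarith [h2.1, h2.2]
  rw [abs_le]
  constructor
  · linarith [nonneg_of_mul_nonneg_left h3 (half_pos hδ)]
  · linarith [nonneg_of_mul_nonneg_left h4 (half_pos hδ)]

lemma le_of_mem_subdiff_right {w : ℝ → ℝ} {t p d : ℝ} (hp : p ∈ subdiff w t)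
    (hd : HasDerivWithinAt w d (Ioi t) t) : p ≤ d := by
  refine le_of_forall_pos_le_add fun ε hε => ?_
  have h1 := (hasDerivWithinAt_iff_isLittleO.1 hd).def (half_pos hε)
  obtain ⟨s, ⟨hs1, hs2⟩, hs3⟩ := ((h1.and ((hp (ε / 2) (by positivity)).filter_mono
    nhdsWithin_le_nhds)).and self_mem_nhdsWithin).exists
  have hs : 0 < s - t := sub_pos.2 hs3
  rw [Real.norm_eq_abs, Real.norm_eq_abs, smul_eq_mul, abs_of_pos hs] at hs1
  rw [abs_of_pos hs] at hs2
  have h2 := le_abs_self (w s - w t - (s - t) * d)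
  have : 0 ≤ (d + ε - p) * (s - t) := by nlinarith
  linarith [nonneg_of_mul_nonneg_left this hs]

lemma le_of_mem_subdiff_left {w : ℝ → ℝ} {t p d : ℝ} (hp : p ∈ subdiff w t)
    (hd : HasDerivWithinAt w d (Iio t) t) : d ≤ p := by
  refine le_of_forall_pos_le_add fun ε hε => ?_
  have h1 := (hasDerivWithinAt_iff_isLittleO.1 hd).def (half_pos hε)
  obtain ⟨s, ⟨hs1, hs2⟩, hs3⟩ := ((h1.and ((hp (ε / 2) (by positivity)).filter_mono
    nhdsWithin_le_nhds)).and self_mem_nhdsWithin).exists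
  have hs : 0 < t - s := sub_pos.2 hs3
  rw [Real.norm_eq_abs, Real.norm_eq_abs, smul_eq_mul, abs_sub_comm s t, abs_of_pos hs] at hs1
  rw [abs_sub_comm s t, abs_of_pos hs] at hs2
  have h2 := le_abs_self (w s - w t - (s - t) * d)
  have : 0 ≤ (p + ε - d) * (t - s) := by nlinarith
  linarith [nonneg_of_mul_nonneg_left this hs]

lemma continuousOn_value_comp (h : EikonalData a f g) {I : Set ℝ} (hI : I.OrdConnected)
    {ξ : ℝ → Plane} (hξ : IsUnitCurve a I (gasket a) ξ) :
    ContinuousOn (fun t => value a f g (ξ t)) I := by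
  refine (continuousOn_value h).comp ?_ hξ.1
  have : LipschitzOnWith 1 ξ I := LipschitzOnWith.of_dist_le_mul fun s hs t ht => by
    simpa [Real.dist_eq] using hξ.dist_le h.side hI subset_rfl s hs t ht
  exact this.continuousOn

lemma isMetricSubsolution_value (h : EikonalData a f g) :
    IsMetricSubsolution a f (value a f g) where
  usc I ξ hI hξ := (continuousOn_value_comp h hI hξ).upperSemicontinuousOn
  visc x hx I ξ hI hIo h0 hξ hξ0 p hp := by
    have hL := hξ.dist_le h.side hI sdiff_subset
    have hmem : ∀ t ∈ I, ξ t ∈ gasket a := fun t ht => (hξ.1 ht).1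
    refine abs_le_of_mem_superdiff hp fun ε hε => ?_
    have hξc : Tendsto ξ (𝓝 0) (𝓝[gasket a] x) := by
      refine tendsto_nhdsWithin_iff.2 ⟨?_, mem_of_superset (hIo.mem_nhds h0) hmem⟩
      have : LipschitzOnWith 1 ξ I := LipschitzOnWith.of_dist_le_mul fun s hs t ht => by
        simpa [Real.dist_eq] using hL s hs t ht
      exact hξ0 ▸ this.continuousOn.continuousAt (hIo.mem_nhds h0)
    have hf : ∀ᶠ t in 𝓝 (0 : ℝ), f (ξ t) < f x + ε :=
      ((h.cont x hx.1).tendsto.comp hξc).eventually_lt_const (by linarith)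
    obtain ⟨δ, hδ, hball⟩ := Metric.eventually_nhds_iff.1 (hf.and (hIo.mem_nhds h0))
    refine Metric.eventually_nhds_iff.2 ⟨δ, hδ, fun s hs => ?_⟩
    rw [Real.dist_eq, sub_zero] at hs
    rw [sub_zero]
    have hin : ∀ r ∈ Icc (-|s|) |s|, f (ξ r) < f x + ε ∧ r ∈ I := fun r hr =>
      hball (by rw [Real.dist_eq, sub_zero]; exact (abs_le.2 hr).trans_lt hs)
    obtain ⟨η, hη, hηe⟩ := exists_isLipCurve_eqOn (s := -|s|) (t := |s|)
      (by linarith [abs_nonneg s])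
      (fun r hr r' hr' => hL r (hin r hr).2 r' (hin r' hr').2) fun r hr => hmem r (hin r hr).2
    have hbd : ∀ r r', r ≤ r' → -|s| ≤ r → r' ≤ |s| →
        ∫ q in r..r', f (η q) ≤ (f x + ε) * (r' - r) := fun r r' hrr h1 h2 => by
      have := intervalIntegral.integral_mono_on hrr (h.intervalIntegrable hη _ _)
        (intervalIntegrable_const (c := f x + ε)) fun q hq => by
          have hq' : q ∈ Icc (-|s|) |s| := ⟨h1.trans hq.1, hq.2.trans h2⟩
          rw [hηe hq']; exact (hin q hq').1.le
      rw [intervalIntegral.integral_const, smul_eq_mul] at this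
      linarith
    have e0 : η 0 = ξ 0 := hηe ⟨by simp, abs_nonneg s⟩
    have es : η s = ξ s := hηe ⟨neg_abs_le s, le_abs_self s⟩
    rw [← e0, ← es]
    rcases le_total 0 s with h' | h'
    · have h1 := abs_value_sub_le h hη h'
      have h2 := hbd 0 s h' (by simp) (le_abs_self s)
      have h3 := le_abs_self (value a f g (η 0) - value a f g (η s))
      rw [abs_of_nonneg h']
      linarith
    · have h1 := abs_value_sub_le h hη h'
      have h2 := hbd s 0 h' (neg_abs_le s) (abs_nonneg s)
      have h3 := neg_abs_le (value a f g (η s) - value a f g (η 0))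
      rw [abs_of_nonpos h']
      linarith

/-- The curve required at `x` is a nearly optimal curve to a corner, run in both time
directions; `w` decreases from the value at `x` at the exact rate `f` along it. -/
lemma isMetricSupersolution_value (h : EikonalData a f g) :
    IsMetricSupersolution a f (value a f g) where
  lsc I ξ hI hξ := (continuousOn_value_comp h hI hξ).lowerSemicontinuousOn
  visc x hx ε hε := by
    obtain ⟨_, ⟨ξ₀, T, j, hξ₀, hT, h0, hj, rfl⟩, hlt⟩ :=
      exists_lt_of_csInf_lt (costs_nonempty h hx.1)
        (show sInf (costs a f g x) < value a f g x + ε by change value a f g x < _; linarith)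
    have hξ : IsLipCurve a fun t => ξ₀ (min |t| T) := by
      refine hξ₀.comp (φ := fun t => min |t| T) ?_
      exact lipschitzWith_one_norm.min_const T
    set ξ : ℝ → Plane := fun t => ξ₀ (min |t| T) with hξdef
    have heven : ∀ t, ξ (-t) = ξ t := fun t => by simp [hξdef]
    have hξT : ∀ t, |t| ≤ T → ξ t = ξ₀ |t| := fun t ht => by simp [hξdef, ht]
    have hF := h.continuous_comp hξ
    set A : ℝ → ℝ := fun t => ∫ r in (0 : ℝ)..t, f (ξ r) with hA
    have hA' : ∀ t, HasDerivAt A (f (ξ t)) t := fun t =>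
      intervalIntegral.integral_hasDerivAt_right (hF.intervalIntegrable _ _)
        (hF.stronglyMeasurableAtFilter _ _) hF.continuousAt
    have hAc : Continuous A := continuous_iff_continuousAt.2 fun t => (hA' t).continuousAt
    have hTc : ξ T ∈ corners a := by
      rw [hξT T (abs_of_nonneg hT).le, abs_of_nonneg hT, hj]; exact ⟨j, rfl⟩
    have hTc' : ξ (-T) ∈ corners a := by rwa [heven]
    have hTp := isGLB_csInf (s := {t | 0 ≤ t ∧ ξ t ∈ corners a}) ⟨T, hT, hTc⟩ ⟨0, fun t ht => ht.1⟩
    have hTm := isLUB_csSup (s := {t | t ≤ 0 ∧ ξ t ∈ corners a}) ⟨-T, by simpa using hT, hTc'⟩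
      ⟨0, fun t ht => ht.1⟩
    refine ⟨ξ, fun t => value a f g x - A |t|, _, _, hξ.isUnitCurve h.side fun t _ => hξ.2 t,
      by simp [hξdef, hT, h0], (by fun_prop : Continuous _).lowerSemicontinuous, hTp, hTm,
      by simp [hA], fun t ht => ?_, fun t _ p hp => ?_⟩
    · have htT : |t| ≤ T := abs_le.2
        ⟨(hTm.1 ⟨by simpa using hT, hTc'⟩).trans ht.1.le, ht.2.le.trans (hTp.1 ⟨hT, hTc⟩)⟩
      have h1 := value_le_integral_add h hξ₀ htT
      rw [hj, value_corner h] at h1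
      have h2 : A |t| = ∫ r in (0 : ℝ)..|t|, f (ξ₀ r) := by
        refine intervalIntegral.integral_congr fun r hr => ?_
        rw [uIcc_of_le (abs_nonneg t)] at hr
        rw [hξT r (by rw [abs_of_nonneg hr.1]; exact hr.2.trans htT), abs_of_nonneg hr.1]
      have h3 := intervalIntegral.integral_add_adjacent_intervals
        (h.intervalIntegrable hξ₀ 0 |t|) (h.intervalIntegrable hξ₀ |t| T)
      change value a f g (ξ t) - ε ≤ value a f g x - A |t|
      rw [h2, hξT t htT]
      linarith
    · have hle : f (ξ t) ≤ |p| := by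
        rcases le_or_gt 0 t with ht | ht
        · have hd : HasDerivWithinAt (fun s => value a f g x - A |s|) (-f (ξ t)) (Ioi t) t := by
            refine ((hA' t).const_sub (value a f g x)).hasDerivWithinAt.congr
              (fun s hs => ?_) (by rw [abs_of_nonneg ht])
            rw [abs_of_nonneg (ht.trans (le_of_lt hs))]
          linarith [le_of_mem_subdiff_right hp hd, neg_abs_le p]
        · have hd : HasDerivWithinAt (fun s => value a f g x - A |s|) (f (ξ t)) (Iio t) t := by
            have h1 : HasDerivAt (fun s => A (-s)) (-f (ξ t)) t := by
              have := (hA' (-t)).comp t (hasDerivAt_neg t)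
              simpa [heven, Function.comp_def] using this
            have h2 := h1.const_sub (value a f g x)
            rw [neg_neg] at h2
            refine h2.hasDerivWithinAt.congr (fun s hs => ?_) (by rw [abs_of_neg ht])
            rw [abs_of_neg (lt_trans hs ht)]
          linarith [le_of_mem_subdiff_left hp hd, le_abs_self p]
      linarith

lemma isMetricSolution_value (h : EikonalData a f g) : IsMetricSolution a f g (value a f g) :=
  ⟨isMetricSubsolution_value h, isMetricSupersolution_value h, value_corner h⟩

/-! ### Uniqueness of the metric viscosity solution -/

lemma IsMetricSolution.continuous_comp (h : EikonalData a f g) {v : Plane → ℝ}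
    (hv : IsMetricSolution a f g v) {ξ : ℝ → Plane} (hξ : IsLipCurve a ξ) :
    Continuous fun t => v (ξ t) := by
  have hu := hξ.isUnitCurve h.side (I := univ) fun t _ => hξ.2 t
  rw [← continuousOn_univ, continuousOn_iff_lower_upperSemicontinuousOn]
  exact ⟨hv.super.lsc _ ξ ordConnected_univ hu, hv.sub.usc _ ξ ordConnected_univ hu⟩

/-- Up to its first hitting time of the corners, a solution grows at rate at most `f` along a
curve; from then on compatibility of the boundary data takes over. -/
lemma IsMetricSolution.le_value (h : EikonalData a f g) {v : Plane → ℝ}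
    (hv : IsMetricSolution a f g v) {x : Plane} (hx : x ∈ gasket a) :
    v x ≤ value a f g x := by
  refine le_csInf (costs_nonempty h hx) ?_
  rintro _ ⟨ξ, T, j, hξ, hT, rfl, hj, rfl⟩
  have hcl : IsCompact {t | t ∈ Icc 0 T ∧ ξ t ∈ corners a} :=
    isCompact_Icc.inter_right ((finite_range a).isClosed.preimage hξ.continuous)
  obtain ⟨τ, ⟨hτ, k, hk⟩, hmin⟩ := hcl.exists_isLeast ⟨T, ⟨hT, le_rfl⟩, j, hj.symm⟩
  have h1 : |v (ξ 0) - v (ξ τ)| ≤ ∫ r in (0 : ℝ)..τ, f (ξ r) := by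
    refine abs_sub_le_integral_of_touching_above (u := fun t => v (ξ t)) hτ.1
      (hv.continuous_comp h hξ).continuousOn (h.continuous_comp hξ) fun t ht φ p hφ hφ' hmax => ?_
    have hoff : MapsTo (fun s => ξ (s + t)) (Ioo (-t) (τ - t)) (gasket a \ corners a) :=
      fun s hs => ⟨hξ.2 _, fun hc => by
        have := hmin ⟨⟨by linarith [hs.1], by linarith [hs.2, hτ.2]⟩, hc⟩
        linarith [hs.2]⟩
    have hxt : ξ t ∈ gasket a \ corners a := by
      simpa using hoff (show (0 : ℝ) ∈ Ioo (-t) (τ - t) from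
        ⟨by linarith [ht.1], by linarith [ht.2]⟩)
    have hp := mem_superdiff_of_isLocalMax hφ' (hmax.isLocalMax (Icc_mem_nhds ht.1 ht.2))
    refine hv.sub.visc (ξ t) hxt _ (fun s => ξ (s + t)) ordConnected_Ioo isOpen_Ioo
      ⟨by linarith [ht.1], by linarith [ht.2]⟩ ((hξ.comp_add t).isUnitCurve h.side hoff)
      (by simp) p fun ε hε => ?_
    have h2 : Tendsto (fun s : ℝ => s + t) (𝓝 0) (𝓝 t) := by
      simpa using (continuous_add_const t).tendsto 0
    filter_upwards [h2.eventually (hp ε hε)] with s hs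
    simpa using hs
  have h2 := value_le_integral_add h hξ hτ.2
  rw [hj, ← hk, value_corner h, value_corner h] at h2
  rw [← hk, hv.boundary] at h1
  have h3 := intervalIntegral.integral_add_adjacent_intervals
    (h.intervalIntegrable hξ 0 τ) (h.intervalIntegrable hξ τ T)
  linarith [le_abs_self (v (ξ 0) - g k)]

lemma IsMetricSolution.value_le (h : EikonalData a f g) {v : Plane → ℝ}
    (hv : IsMetricSolution a f g v) {x : Plane} (hx : x ∈ gasket a) :
    value a f g x ≤ v x := by
  by_cases hxc : x ∈ corners a
  · obtain ⟨i, rfl⟩ := hxc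
    rw [value_corner h, hv.boundary]
  obtain ⟨c, hc, hcf⟩ := h.pos
  obtain ⟨m, hm⟩ := exists_le_boundary g
  have key : ∀ ε ∈ Ioo 0 c, value a f g x ≤ v x + ε * (1 + (value a f g x - m) / c) := by
    intro ε hε
    obtain ⟨ξ, w, Tm, Tp, hu, rfl, hw, hTp, hTm, hw0, hwge, hwsub⟩ :=
      hv.super.visc x ⟨hx, hxc⟩ ε hε.1
    have hξ : IsLipCurve a ξ := ⟨lipschitzWith_one_iff.2 fun s t =>
      hu.dist_le h.side ordConnected_univ subset_rfl s trivial t trivial,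
      fun t => hu.1 (mem_univ t)⟩
    have hcl : IsClosed {t | ξ t ∈ corners a} := (finite_range a).isClosed.preimage hξ.continuous
    have hpne : {t | 0 ≤ t ∧ ξ t ∈ corners a}.Nonempty := by
      by_contra hne
      rw [not_nonempty_iff_eq_empty] at hne
      rw [hne] at hTp
      exact not_isTop _ (isGLB_empty_iff.1 hTp)
    have hmne : {t | t ≤ 0 ∧ ξ t ∈ corners a}.Nonempty := by
      by_contra hne
      rw [not_nonempty_iff_eq_empty] at hne
      rw [hne] at hTm
      exact not_isBot _ (isLUB_empty_iff.1 hTm)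
    obtain ⟨hp0, j, hj⟩ := hTp.mem_of_isClosed hpne (isClosed_Ici.inter hcl)
    obtain ⟨hm0, i, hi⟩ := hTm.mem_of_isClosed hmne (isClosed_Iic.inter hcl)
    have hp0 : 0 < Tp := lt_of_le_of_ne hp0 fun e => hxc (by rw [e, ← hj]; exact ⟨j, rfl⟩)
    have hm0 : Tm < 0 := lt_of_le_of_ne hm0 fun e => hxc (by rw [← e, ← hi]; exact ⟨i, rfl⟩)
    have hF : Continuous fun t => f (ξ t) - ε := (h.continuous_comp hξ).sub continuous_const
    -- the comparison principle on the intervals that exhaust `(Tm, Tp)`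
    have hcmp : ∀ δ ∈ Ioo 0 (min Tp (-Tm)),
        min (v (ξ (Tm + δ)) + ∫ s in (Tm + δ)..0, (f (ξ s) - ε))
          (v (ξ (Tp - δ)) + ∫ s in (0 : ℝ)..(Tp - δ), (f (ξ s) - ε)) ≤ v (ξ 0) + ε := by
      intro δ hδ
      obtain ⟨hδ1, hδ2⟩ := lt_min_iff.1 hδ.2
      have h1 := min_add_integral_le_of_touching_below (w := w) (F := fun t => f (ξ t) - ε)
        (α := Tm + δ) (β := Tp - δ) (t := 0) (hw.lowerSemicontinuousOn _) hF
        (fun t => by linarith [hcf _ (hξ.2 t), hε.2])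
        (fun t ht φ p _ hφ' hmin => hwsub t ⟨by linarith [ht.1, hδ.1], by linarith [ht.2, hδ.1]⟩ p
          (mem_subdiff_of_isLocalMin hφ' (hmin.isLocalMin (Icc_mem_nhds ht.1 ht.2))))
        ⟨by linarith, by linarith⟩
      have h2 := hwge (Tm + δ) ⟨by linarith [hδ.1], by linarith [hδ.1]⟩
      have h3 := hwge (Tp - δ) ⟨by linarith [hδ.1], by linarith [hδ.1]⟩
      rw [hw0] at h1
      rw [← sub_le_iff_le_add]
      refine le_trans ?_ h1
      refine le_min ((sub_le_sub_right (min_le_left _ _) _).trans ?_)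
        ((sub_le_sub_right (min_le_right _ _) _).trans ?_) <;> linarith
    have hvc := hv.continuous_comp h hξ
    have hprim : Continuous fun t => ∫ s in (0 : ℝ)..t, (f (ξ s) - ε) :=
      intervalIntegral.continuous_primitive (fun _ _ => hF.intervalIntegrable _ _) 0
    have hlim : Tendsto (fun δ => min (v (ξ (Tm + δ)) + ∫ s in (Tm + δ)..0, (f (ξ s) - ε))
          (v (ξ (Tp - δ)) + ∫ s in (0 : ℝ)..(Tp - δ), (f (ξ s) - ε))) (𝓝[>] 0)
        (𝓝 (min (v (ξ (Tm + 0)) + ∫ s in (Tm + 0)..0, (f (ξ s) - ε))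
          (v (ξ (Tp - 0)) + ∫ s in (0 : ℝ)..(Tp - 0), (f (ξ s) - ε)))) := by
      refine Tendsto.mono_left (Continuous.tendsto ?_ 0) nhdsWithin_le_nhds
      refine Continuous.min ?_ ?_
      · simp only [intervalIntegral.integral_symm 0]
        exact (hvc.comp (continuous_const_add Tm)).add (hprim.comp (continuous_const_add Tm)).neg
      · exact (hvc.comp (continuous_sub_left Tp)).add (hprim.comp (continuous_sub_left Tp))
    have hfin := le_of_tendsto hlim (mem_of_superset
      (Ioo_mem_nhdsGT (lt_min hp0 (neg_pos.2 hm0))) hcmp)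
    rw [add_zero, sub_zero, ← hi, ← hj, hv.boundary, hv.boundary] at hfin
    -- the loss of `ε` in the rate is a factor `1 - ε / c` in the cost
    have hrate : ∀ s t : ℝ, s ≤ t → (1 - ε / c) * ∫ r in s..t, f (ξ r) ≤
        ∫ r in s..t, (f (ξ r) - ε) := fun s t hst => by
      rw [← intervalIntegral.integral_const_mul]
      refine intervalIntegral.integral_mono_on hst ((h.intervalIntegrable hξ _ _).const_mul _)
        (hF.intervalIntegrable _ _) fun r _ => ?_
      have := hcf _ (hξ.2 r)
      have h1 : ε / c * c ≤ ε / c * f (ξ r) := by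
        have := hε.1
        gcongr
      rw [div_mul_cancel₀ _ hc.ne'] at h1
      linarith
    have hfac : 0 ≤ 1 - ε / c := sub_nonneg.2 ((div_le_one hc).2 hε.2.le)
    have hend : ∀ (k : Fin 3) (X Y : ℝ), value a f g (ξ 0) ≤ X + g k → (1 - ε / c) * X ≤ Y →
        g k + Y ≤ v (ξ 0) + ε →
        value a f g (ξ 0) ≤ v (ξ 0) + ε * (1 + (value a f g (ξ 0) - m) / c) := by
      intro k X Y h1 h2 h3
      have h4 : (1 - ε / c) * (value a f g (ξ 0) - g k) ≤ (1 - ε / c) * X := by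
        gcongr; linarith
      have h5 : ε / c * (value a f g (ξ 0) - g k) ≤ ε / c * (value a f g (ξ 0) - m) := by
        have := hε.1
        gcongr; exact hm k
      have h6 : ε * ((value a f g (ξ 0) - m) / c) = ε / c * (value a f g (ξ 0) - m) := by ring
      linarith
    rcases min_le_iff.1 hfin with h1 | h1
    · have h2 := abs_value_sub_le h hξ hm0.le
      rw [← hi, value_corner h] at h2
      have h3 := neg_abs_le (g i - value a f g (ξ 0))
      exact hend i _ _ (by linarith) (hrate _ _ hm0.le) h1
    · have h2 := value_le_integral_add h hξ hp0.le
      rw [← hj, value_corner h] at h2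
      exact hend j _ _ h2 (hrate _ _ hp0.le) h1
  have hlim : Tendsto (fun ε : ℝ => v x + ε * (1 + (value a f g x - m) / c)) (𝓝[>] 0)
      (𝓝 (v x + 0 * (1 + (value a f g x - m) / c))) :=
    Tendsto.mono_left (Continuous.tendsto (by fun_prop) 0) nhdsWithin_le_nhds
  rw [zero_mul, add_zero] at hlim
  exact ge_of_tendsto hlim (mem_of_superset (Ioo_mem_nhdsGT hc) key)

/-! ### Comparison on the networks -/

/-- The cost `f` along the edge from `x` to `y`, extended to the real line by its end values. -/
def edgeRate (f : Plane → ℝ) (n : ℕ) (x y : Plane) (t : ℝ) : ℝ :=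
  f (edgeParam n x y (projIcc 0 (edgeLength n) (edgeLength_pos n).le t))

lemma edgeRate_of_mem (f : Plane → ℝ) {n : ℕ} (x y : Plane) {t : ℝ}
    (ht : t ∈ Icc 0 (edgeLength n)) : edgeRate f n x y t = f (edgeParam n x y t) := by
  rw [edgeRate, projIcc_of_mem _ ht]

lemma continuous_edgeRate (h : EikonalData a f g) {n : ℕ} {x y : Plane} (hxy : Adj a n x y) :
    Continuous (edgeRate f n x y) :=
  h.cont.comp_continuous
    ((continuous_edgeParam n x y).comp (continuous_subtype_val.comp continuous_projIcc))
    fun t => edgeParam_mem_gasket h.side hxy (projIcc _ _ (edgeLength_pos n).le t).2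

lemma edgeRate_pos (h : EikonalData a f g) {n : ℕ} {x y : Plane} (hxy : Adj a n x y) (t : ℝ) :
    0 < edgeRate f n x y t :=
  h.fpos (edgeParam_mem_gasket h.side hxy (projIcc _ _ (edgeLength_pos n).le t).2)

lemma intervalIntegrable_edgeRate (h : EikonalData a f g) {n : ℕ} {x y : Plane}
    (hxy : Adj a n x y) (s t : ℝ) : IntervalIntegrable (edgeRate f n x y) volume s t :=
  (continuous_edgeRate h hxy).intervalIntegrable _ _

lemma integral_edgeRate_nonneg (h : EikonalData a f g) {n : ℕ} {x y : Plane}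
    (hxy : Adj a n x y) {s t : ℝ} (hst : s ≤ t) : 0 ≤ ∫ r in s..t, edgeRate f n x y r :=
  intervalIntegral.integral_nonneg hst fun r _ => (edgeRate_pos h hxy r).le

lemma integral_edgeRate_pos (h : EikonalData a f g) {n : ℕ} {x y : Plane}
    (hxy : Adj a n x y) : 0 < ∫ r in (0 : ℝ)..edgeLength n, edgeRate f n x y r :=
  intervalIntegral.intervalIntegral_pos_of_pos (intervalIntegrable_edgeRate h hxy _ _)
    (edgeRate_pos h hxy) (edgeLength_pos n)

lemma integral_edgeRate_symm (f : Plane → ℝ) {n : ℕ} (x y : Plane) {t : ℝ}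
    (ht : t ∈ Icc 0 (edgeLength n)) :
    ∫ r in (0 : ℝ)..(edgeLength n - t), edgeRate f n y x r =
      ∫ r in t..edgeLength n, edgeRate f n x y r := by
  have h1 : ∫ r in t..edgeLength n, edgeRate f n x y r =
      ∫ r in t..edgeLength n, edgeRate f n y x (edgeLength n - r) := by
    refine intervalIntegral.integral_congr fun r hr => ?_
    rw [uIcc_of_le ht.2] at hr
    rw [edgeRate_of_mem f x y ⟨ht.1.trans hr.1, hr.2⟩,
      edgeRate_of_mem f y x ⟨by linarith [hr.2], by linarith [hr.1, ht.1]⟩, edgeParam_symm]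
  rw [h1, intervalIntegral.integral_comp_sub_left]
  simp

lemma dist_left_edgeParam (ha : ∀ i j, i ≠ j → dist (a i) (a j) = 1) {n : ℕ} {x y : Plane}
    (hxy : Adj a n x y) {t : ℝ} (ht : 0 ≤ t) : dist x (edgeParam n x y t) = t := by
  have := dist_edgeParam ha hxy 0 t
  rwa [edgeParam_zero, zero_sub, abs_neg, abs_of_nonneg ht] at this

/-- A test function on a part `[α, β]` of an edge extends to the network. The extension differs
from `v` by a function of the projection `π` to the edge only, so that no information on the
position of the other edges is needed. -/
lemma exists_edge_test (ha : ∀ i j, i ≠ j → dist (a i) (a j) = 1) {n : ℕ} {x y : Plane}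
    (hxy : Adj a n x y) {v : Plane → ℝ} (hv : ContinuousOn v (prefractal a n)) {α β : ℝ}
    (hα : 0 ≤ α) (hβ : β ≤ edgeLength n) {Φ : ℝ → ℝ} (hΦ : Continuous Φ) {t p : ℝ}
    (ht : t ∈ Ioo α β) (hp : HasDerivAt Φ p t) :
    ∃ (φ : Plane → ℝ) (π : Plane → ℝ), ContinuousOn φ (prefractal a n) ∧
      HasEdgeDeriv n φ x y t p ∧ (∀ z, π z ∈ Icc α β) ∧ π (edgeParam n x y t) = t ∧
      ∀ z, v z - φ z = v (edgeParam n x y (π z)) - Φ (π z) := by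
  have hαβ : α ≤ β := (ht.1.trans ht.2).le
  set π : Plane → ℝ := fun z => projIcc α β hαβ (dist x z) with hπ
  have hπc : Continuous π :=
    continuous_subtype_val.comp (continuous_projIcc.comp (continuous_const.dist continuous_id))
  have hπm : ∀ z, π z ∈ Icc α β := fun z => (projIcc α β hαβ (dist x z)).2
  have hπe : ∀ s ∈ Icc α β, π (edgeParam n x y s) = s := fun s hs => by
    simp only [hπ]
    rw [dist_left_edgeParam ha hxy (hα.trans hs.1), projIcc_of_mem hαβ hs]
  refine ⟨fun z => v z - (v (edgeParam n x y (π z)) - Φ (π z)), π, ?_, ?_, hπm,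
    hπe t (Ioo_subset_Icc_self ht), fun z => by ring⟩
  · refine hv.sub (ContinuousOn.sub ?_ (hΦ.comp hπc).continuousOn)
    refine hv.comp ((continuous_edgeParam n x y).comp hπc).continuousOn fun z _ => ?_
    exact edgeParam_mem_prefractal hxy ⟨hα.trans (hπm z).1, (hπm z).2.trans hβ⟩
  · refine (hp.congr_of_eventuallyEq ?_).hasDerivWithinAt
    filter_upwards [Icc_mem_nhds ht.1 ht.2] with s hs
    rw [hπe s hs]
    ring

lemma IsNetworkSolution.continuousOn {n : ℕ} {v : Plane → ℝ}
    (hv : IsNetworkSolution a f g n v) : ContinuousOn v (prefractal a n) :=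
  continuousOn_iff_lower_upperSemicontinuousOn.2 ⟨hv.super.lsc, hv.sub.usc⟩

lemma IsNetworkSolution.continuousOn_edge {n : ℕ} {v : Plane → ℝ}
    (hv : IsNetworkSolution a f g n v) {x y : Plane} (hxy : Adj a n x y) :
    ContinuousOn (fun s => v (edgeParam n x y s)) (Icc 0 (edgeLength n)) :=
  hv.continuousOn.comp (continuous_edgeParam n x y).continuousOn
    fun _ hs => edgeParam_mem_prefractal hxy hs

/-- A solution grows along an edge at rate at most `f`. -/
lemma IsNetworkSolution.abs_sub_le (h : EikonalData a f g) {n : ℕ} {v : Plane → ℝ}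
    (hv : IsNetworkSolution a f g n v) {x y : Plane} (hxy : Adj a n x y) {s t : ℝ}
    (hs : 0 ≤ s) (hst : s ≤ t) (ht : t ≤ edgeLength n) :
    |v (edgeParam n x y s) - v (edgeParam n x y t)| ≤ ∫ r in s..t, edgeRate f n x y r := by
  refine abs_sub_le_integral_of_touching_above (u := fun s => v (edgeParam n x y s)) hst
    ((hv.continuousOn_edge hxy).mono (Icc_subset_Icc hs ht)) (continuous_edgeRate h hxy)
    fun r hr Φ p hΦ hp hmax => ?_
  obtain ⟨φ, π, hφc, hφd, hπ, hπr, hφv⟩ :=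
    exists_edge_test h.side hxy hv.continuousOn hs ht hΦ hr hp
  have hr' : r ∈ Ioo 0 (edgeLength n) := ⟨hs.trans_lt hr.1, hr.2.trans_le ht⟩
  rw [edgeRate_of_mem f x y (Ioo_subset_Icc_self hr')]
  refine hv.sub.edge x y hxy r hr' φ p hφc hφd (Eventually.of_forall fun z => ?_)
  dsimp only
  rw [hφv, hφv, hπr]
  exact hmax (hπ z)

lemma IsNetworkSolution.rate_le_of_isMinOn (h : EikonalData a f g) {n : ℕ} {v : Plane → ℝ}
    (hv : IsNetworkSolution a f g n v) {x y : Plane} (hxy : Adj a n x y) {t p : ℝ}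
    (ht : t ∈ Ioo 0 (edgeLength n)) {Φ : ℝ → ℝ} (hΦ : Continuous Φ) (hp : HasDerivAt Φ p t)
    (hmin : IsMinOn (fun s => v (edgeParam n x y s) - Φ s) (Icc 0 (edgeLength n)) t) :
    f (edgeParam n x y t) ≤ |p| := by
  obtain ⟨φ, π, hφc, hφd, hπ, hπr, hφv⟩ :=
    exists_edge_test h.side hxy hv.continuousOn le_rfl le_rfl hΦ ht hp
  refine hv.super.edge x y hxy t ht φ p hφc hφd (Eventually.of_forall fun z => ?_)
  dsimp only
  rw [hφv, hφv, hπr]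
  exact hmin (hπ z)

/-- On an edge, a solution dominates the solution of the equation with the same end values. -/
lemma IsNetworkSolution.min_le_edge (h : EikonalData a f g) {n : ℕ} {v : Plane → ℝ}
    (hv : IsNetworkSolution a f g n v) {x y : Plane} (hxy : Adj a n x y) {t : ℝ}
    (ht : t ∈ Icc 0 (edgeLength n)) :
    min (v x + ∫ r in (0 : ℝ)..t, edgeRate f n x y r)
      (v y + ∫ r in t..edgeLength n, edgeRate f n x y r) ≤ v (edgeParam n x y t) := by
  have := min_add_integral_le_of_touching_below (w := fun s => v (edgeParam n x y s))
    (hv.continuousOn_edge hxy).lowerSemicontinuousOn (continuous_edgeRate h hxy)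
    (edgeRate_pos h hxy) (fun s hs Φ p hΦ hp hmin => by
      rw [edgeRate_of_mem f x y (Ioo_subset_Icc_self hs)]
      exact hv.rate_le_of_isMinOn h hxy hs hΦ hp hmin) ht
  simpa using this

/-- The concatenation of the edge from `z` to `x` and of the edge from `x` to `y`, parametrized
by arc length over `[-edgeLength n, edgeLength n]`, with `x` at the origin. -/
def cornerParam (n : ℕ) (x y z : Plane) (t : ℝ) : Plane :=
  x + (max t 0 / edgeLength n) • (y - x) + (max (-t) 0 / edgeLength n) • (z - x)

lemma cornerParam_of_nonneg (n : ℕ) (x y z : Plane) {t : ℝ} (ht : 0 ≤ t) :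
    cornerParam n x y z t = edgeParam n x y t := by
  simp [cornerParam, edgeParam, ht]

lemma cornerParam_of_nonpos (n : ℕ) (x y z : Plane) {t : ℝ} (ht : t ≤ 0) :
    cornerParam n x y z t = edgeParam n x z (-t) := by
  simp [cornerParam, edgeParam, ht]

lemma continuous_cornerParam (n : ℕ) (x y z : Plane) : Continuous (cornerParam n x y z) := by
  unfold cornerParam
  fun_prop

lemma cornerParam_mem_prefractal {n : ℕ} {x y z : Plane} (hxy : Adj a n x y)
    (hxz : Adj a n x z) {t : ℝ} (ht : t ∈ Icc (-edgeLength n) (edgeLength n)) :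
    cornerParam n x y z t ∈ prefractal a n := by
  rcases le_total 0 t with h | h
  · rw [cornerParam_of_nonneg n x y z h]
    exact edgeParam_mem_prefractal hxy ⟨h, ht.2⟩
  · rw [cornerParam_of_nonpos n x y z h]
    exact edgeParam_mem_prefractal hxz ⟨by linarith, by linarith [ht.1]⟩

/-- Two distinct edges at `x` have a common linear coordinate that is the arc length on the first
one and minus the arc length on the second one. -/
lemma exists_corner_coordinate (ha : ∀ i j, i ≠ j → dist (a i) (a j) = 1) {n : ℕ}
    {x y z : Plane} (hxy : Adj a n x y) (hxz : Adj a n x z) (hyz : y ≠ z) :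
    ∃ π : Plane → ℝ, Continuous π ∧ (∀ t, π (edgeParam n x y t) = t) ∧
      ∀ t, π (edgeParam n x z t) = -t := by
  have hh := (edgeLength_pos n).ne'
  have hD : ‖y - z‖ ≠ 0 := norm_ne_zero_iff.2 (sub_ne_zero.2 hyz)
  have h1 : ‖y - x‖ = edgeLength n := by rw [← dist_eq_norm, dist_comm, hxy.dist_eq ha]
  have h2 : ‖z - x‖ = edgeLength n := by rw [← dist_eq_norm, dist_comm, hxz.dist_eq ha]
  have h3 := norm_sub_sq_real (y - x) (z - x)
  rw [sub_sub_sub_cancel_right, h1, h2] at h3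
  have hyz' : y - z = (y - x) - (z - x) := by abel
  have h4 : inner ℝ (y - x) (y - z) = ‖y - z‖ ^ 2 / 2 := by
    rw [h3, hyz', inner_sub_right, real_inner_self_eq_norm_sq, h1]; ring
  have h5 : inner ℝ (z - x) (y - z) = -(‖y - z‖ ^ 2 / 2) := by
    rw [h3, hyz', inner_sub_right, real_inner_self_eq_norm_sq, h2, real_inner_comm]; ring
  refine ⟨fun q => inner ℝ (q - x) (y - z) * (2 * edgeLength n / ‖y - z‖ ^ 2), by fun_prop,
    fun t => ?_, fun t => ?_⟩
  · simp only [edgeParam, add_sub_cancel_left, real_inner_smul_left, h4]; field_simp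
  · simp only [edgeParam, add_sub_cancel_left, real_inner_smul_left, h5]; field_simp

/-- From every vertex other than a corner, a solution descends along some edge at rate at least
`f`. -/
lemma IsNetworkSolution.exists_descent (h : EikonalData a f g) {n : ℕ} {v : Plane → ℝ}
    (hv : IsNetworkSolution a f g n v) {x : Plane} (hx : x ∈ vertices a n \ corners a) :
    ∃ y, Adj a n x y ∧ v y + ∫ r in (0 : ℝ)..edgeLength n, edgeRate f n x y r ≤ v x := by
  have hh := edgeLength_pos n
  obtain ⟨y, hxy⟩ := exists_adj hx.1
  obtain ⟨z, hxz, hzy, hsup⟩ := hv.super.vertex x hx y hxy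
  obtain ⟨π, hπc, hπy, hπz⟩ := exists_corner_coordinate h.side hxy hxz hzy.symm
  set γ := cornerParam n x y z with hγ
  have hle : -edgeLength n ≤ edgeLength n := by linarith
  set F : ℝ → ℝ := fun t => f (γ (projIcc _ _ hle t)) with hF
  have hFc : Continuous F := h.cont.comp_continuous ((continuous_cornerParam n x y z).comp
    (continuous_subtype_val.comp continuous_projIcc)) fun t => prefractal_subset_gasket h.side n
      (cornerParam_mem_prefractal hxy hxz (projIcc _ _ hle t).2)
  have hFpos : ∀ t, 0 < F t := fun t => h.fpos (prefractal_subset_gasket h.side n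
    (cornerParam_mem_prefractal hxy hxz (projIcc _ _ hle t).2))
  have hFe : ∀ t ∈ Icc (-edgeLength n) (edgeLength n), F t = f (γ t) := fun t ht => by
    simp only [hF]; rw [projIcc_of_mem hle ht]
  have hwc : ContinuousOn (fun t => v (γ t)) (Icc (-edgeLength n) (edgeLength n)) :=
    hv.continuousOn.comp (continuous_cornerParam n x y z).continuousOn
      fun t ht => cornerParam_mem_prefractal hxy hxz ht
  have key := min_add_integral_le_of_touching_below (w := fun t => v (γ t))
    hwc.lowerSemicontinuousOn hFc hFpos (fun t ht Φ p hΦ hp hmin => by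
      rw [hFe t (Ioo_subset_Icc_self ht)]
      rcases lt_trichotomy t 0 with h0 | rfl | h0
      · -- an interior point of the edge from `x` to `z`, which is traversed backwards
        rw [hγ, cornerParam_of_nonpos n x y z h0.le, ← abs_neg]
        have hp' : HasDerivAt (fun s => Φ (-s)) (-p) (-t) := by
          have h1 : HasDerivAt Φ p (- -t) := by rwa [neg_neg]
          simpa [Function.comp_def] using h1.comp (-t) (hasDerivAt_neg (-t))
        refine hv.rate_le_of_isMinOn h hxz ⟨by linarith, by linarith [ht.1]⟩
          (hΦ.comp continuous_neg) hp' fun s hs => ?_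
        have h1 := hmin (show -s ∈ Icc (-edgeLength n) (edgeLength n) from
          ⟨by linarith [hs.2], by linarith [hs.1]⟩)
        simp only [hγ, mem_ofPred_eq, cornerParam_of_nonpos n x y z h0.le,
          cornerParam_of_nonpos n x y z (neg_nonpos.2 hs.1), neg_neg] at h1
        simpa using h1
      · have hγ0 : γ 0 = x := by rw [hγ, cornerParam_of_nonneg n x y z le_rfl, edgeParam_zero]
        rw [hγ0]
        refine hsup (fun q => Φ (π q)) p ⟨(hΦ.comp hπc).continuousOn, -p, ?_, ?_, by ring⟩ ?_
        · simp only [HasEdgeDeriv, hπy]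
          exact hp.hasDerivWithinAt
        · simp only [HasEdgeDeriv, hπz]
          have h1 : HasDerivAt Φ p (-0) := by rwa [neg_zero]
          have h2 : HasDerivAt (fun s => Φ (-s)) (-p) 0 := by
            simpa [Function.comp_def] using h1.comp 0 (hasDerivAt_neg (0 : ℝ))
          exact h2.hasDerivWithinAt
        · have hπx : π x = 0 := by simpa using hπy 0
          have h1 : ∀ s ∈ Icc (-edgeLength n) (edgeLength n), v x - Φ 0 ≤ v (γ s) - Φ s :=
            fun s hs => by simpa [hγ0] using hmin hs
          refine eventually_nhdsWithin_of_forall fun q hq => ?_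
          rw [segment_eq_image_edgeParam n, segment_eq_image_edgeParam n] at hq
          rcases hq with ⟨s, hs, rfl⟩ | ⟨s, hs, rfl⟩
          · have h2 := h1 s ⟨by linarith [hs.1], hs.2⟩
            rw [hγ, cornerParam_of_nonneg n x y z hs.1] at h2
            simpa only [hπy, hπx] using h2
          · have h2 := h1 (-s) ⟨by linarith [hs.2], by linarith [hs.1]⟩
            rw [hγ, cornerParam_of_nonpos n x y z (neg_nonpos.2 hs.1), neg_neg] at h2
            simpa only [hπz, hπx] using h2
      · rw [hγ, cornerParam_of_nonneg n x y z h0.le]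
        refine hv.rate_le_of_isMinOn h hxy ⟨h0, ht.2⟩ hΦ hp fun s hs => ?_
        have h1 := hmin (show s ∈ Icc (-edgeLength n) (edgeLength n) from
          ⟨by linarith [hs.1], hs.2⟩)
        simp only [hγ, mem_ofPred_eq, cornerParam_of_nonneg n x y z h0.le,
          cornerParam_of_nonneg n x y z hs.1] at h1
        exact h1)
    (t := 0) ⟨by linarith, hh.le⟩
  have e0 : γ 0 = x := by rw [hγ, cornerParam_of_nonneg n x y z le_rfl, edgeParam_zero]
  have e1 : γ (edgeLength n) = y := by
    rw [hγ, cornerParam_of_nonneg n x y z hh.le, edgeParam_edgeLength]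
  have e2 : γ (-edgeLength n) = z := by
    rw [hγ, cornerParam_of_nonpos n x y z (by linarith), neg_neg, edgeParam_edgeLength]
  have i1 : ∫ r in (0 : ℝ)..edgeLength n, F r =
      ∫ r in (0 : ℝ)..edgeLength n, edgeRate f n x y r := by
    refine intervalIntegral.integral_congr fun r hr => ?_
    rw [uIcc_of_le hh.le] at hr
    rw [hFe r ⟨by linarith [hr.1], hr.2⟩, edgeRate_of_mem f x y hr, hγ,
      cornerParam_of_nonneg n x y z hr.1]
  have i2 : ∫ r in (-edgeLength n)..0, F r =
      ∫ r in (0 : ℝ)..edgeLength n, edgeRate f n x z r := by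
    have : ∫ r in (-edgeLength n)..0, F r = ∫ r in (-edgeLength n)..0, edgeRate f n x z (-r) := by
      refine intervalIntegral.integral_congr fun r hr => ?_
      rw [uIcc_of_le (by linarith)] at hr
      rw [hFe r ⟨hr.1, by linarith [hr.2]⟩,
        edgeRate_of_mem f x z ⟨by linarith [hr.2], by linarith [hr.1]⟩, hγ,
        cornerParam_of_nonpos n x y z hr.2]
    rw [this, intervalIntegral.integral_comp_neg]
    simp
  rw [e0, e1, e2, i1, i2] at key
  rcases min_le_iff.1 key with h1 | h1
  exacts [⟨z, hxz, h1⟩, ⟨y, hxy, h1⟩]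

/-- Comparison on the network: at a vertex where the inequality fails and the solution is least,
the solution descends to a neighbour, where the inequality fails as well. -/
lemma IsNetworkSolution.le_of_growth (h : EikonalData a f g) {n : ℕ} {v : Plane → ℝ}
    (hv : IsNetworkSolution a f g n v) {u : Plane → ℝ}
    (hu : ∀ x y, Adj a n x y → ∀ t ∈ Icc 0 (edgeLength n),
      u (edgeParam n x y t) ≤ u x + ∫ r in (0 : ℝ)..t, edgeRate f n x y r)
    (hb : ∀ i, u (a i) ≤ g i) : ∀ z ∈ prefractal a n, u z ≤ v z := by
  have hh := edgeLength_pos n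
  have hsymm : ∀ x y, Adj a n x y → ∀ t ∈ Icc 0 (edgeLength n),
      u (edgeParam n x y t) ≤ u y + ∫ r in t..edgeLength n, edgeRate f n x y r := by
    intro x y hxy t ht
    have := hu y x hxy.symm (edgeLength n - t) ⟨by linarith [ht.2], by linarith [ht.1]⟩
    rwa [edgeParam_symm, sub_sub_cancel, integral_edgeRate_symm f x y ht] at this
  have hvert : ∀ x ∈ vertices a n, u x ≤ v x := by
    by_contra! hne
    obtain ⟨x, ⟨hx, hlt⟩, hmin⟩ := ((finite_vertices n).subset
      (sep_subset (vertices a n) fun x => v x < u x)).exists_minimalFor v _ hne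
    have hxc : x ∉ corners a := by
      rintro ⟨i, rfl⟩
      rw [hv.boundary] at hlt
      exact hlt.not_ge (hb i)
    obtain ⟨y, hxy, hy⟩ := hv.exists_descent h ⟨hx, hxc⟩
    have hpos := integral_edgeRate_pos h hxy
    have h1 : u x ≤ u y + ∫ r in (0 : ℝ)..edgeLength n, edgeRate f n x y r := by
      simpa using hsymm x y hxy 0 ⟨le_rfl, hh.le⟩
    have := hmin ⟨hxy.symm.left_mem, by linarith⟩ (by linarith)
    linarith
  intro z hz
  obtain ⟨x, y, hxy, t, ht, rfl⟩ := mem_prefractal_iff.1 hz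
  refine le_trans (le_min ?_ ?_) (hv.min_le_edge h hxy ht)
  · linarith [hu x y hxy t ht, hvert x hxy.left_mem]
  · linarith [hsymm x y hxy t ht, hvert y hxy.symm.left_mem]

lemma IsNetworkSolution.growth (h : EikonalData a f g) {n : ℕ} {v : Plane → ℝ}
    (hv : IsNetworkSolution a f g n v) {x y : Plane} (hxy : Adj a n x y) {t : ℝ}
    (ht : t ∈ Icc 0 (edgeLength n)) :
    v (edgeParam n x y t) ≤ v x + ∫ r in (0 : ℝ)..t, edgeRate f n x y r := by
  have h1 := hv.abs_sub_le h hxy le_rfl ht.1 ht.2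
  rw [edgeParam_zero] at h1
  linarith [neg_abs_le (v x - v (edgeParam n x y t))]

lemma IsNetworkSolution.eqOn (h : EikonalData a f g) {n : ℕ} {v v' : Plane → ℝ}
    (hv : IsNetworkSolution a f g n v) (hv' : IsNetworkSolution a f g n v') :
    EqOn v' v (prefractal a n) := fun z hz =>
  le_antisymm
    (hv.le_of_growth h (fun _ _ hxy _ ht => hv'.growth h hxy ht) (fun i => (hv'.boundary i).le) z hz)
    (hv'.le_of_growth h (fun _ _ hxy _ ht => hv.growth h hxy ht) (fun i => (hv.boundary i).le) z hz)

lemma value_growth (h : EikonalData a f g) {n : ℕ} {x y : Plane} (hxy : Adj a n x y) {t : ℝ}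
    (ht : t ∈ Icc 0 (edgeLength n)) :
    value a f g (edgeParam n x y t) ≤
      value a f g x + ∫ r in (0 : ℝ)..t, edgeRate f n x y r := by
  obtain ⟨η, hη, hηe⟩ := exists_isLipCurve_edge h.side hxy
  have h1 := abs_value_sub_le h hη ht.1
  have h2 : ∫ r in (0 : ℝ)..t, f (η r) = ∫ r in (0 : ℝ)..t, edgeRate f n x y r := by
    refine intervalIntegral.integral_congr fun r hr => ?_
    rw [uIcc_of_le ht.1] at hr
    have hr' : r ∈ Icc 0 (edgeLength n) := ⟨hr.1, hr.2.trans ht.2⟩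
    rw [hηe hr', edgeRate_of_mem f x y hr']
  rw [h2, hηe ht, hηe ⟨le_rfl, (edgeLength_pos n).le⟩, edgeParam_zero] at h1
  linarith [neg_abs_le (value a f g x - value a f g (edgeParam n x y t))]

/-! ### Existence on the networks -/

/-- `NetworkCost a f g n z c`: some path in the network of level `n` leads from `z` to a corner
at total cost `c`, boundary value included. It consists of a part of an edge, which ends at a
vertex, and of edges. -/
inductive NetworkCost (a : Fin 3 → Plane) (f : Plane → ℝ) (g : Fin 3 → ℝ) (n : ℕ) :
    Plane → ℝ → Prop
  | corner (i : Fin 3) : NetworkCost a f g n (a i) (g i)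
  | step {x y : Plane} {c t : ℝ} (hxy : Adj a n x y) (ht : t ∈ Icc 0 (edgeLength n))
      (hc : NetworkCost a f g n x c) :
      NetworkCost a f g n (edgeParam n x y t) (c + ∫ r in (0 : ℝ)..t, edgeRate f n x y r)

/-- The value function of the network of level `n`. -/
def networkValue (a : Fin 3 → Plane) (f : Plane → ℝ) (g : Fin 3 → ℝ) (n : ℕ) (z : Plane) : ℝ :=
  sInf {c | NetworkCost a f g n z c}

lemma NetworkCost.value_le (h : EikonalData a f g) {n : ℕ} {z : Plane} {c : ℝ}
    (hc : NetworkCost a f g n z c) : value a f g z ≤ c := by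
  induction hc with
  | corner i => exact (value_corner h i).le
  | step hxy ht _ ih => linarith [value_growth h hxy ht]

lemma networkValue_le (h : EikonalData a f g) {n : ℕ} {z : Plane} {c : ℝ}
    (hc : NetworkCost a f g n z c) : networkValue a f g n z ≤ c :=
  csInf_le ⟨value a f g z, fun _ hc => hc.value_le h⟩ hc

/-- Any two vertices of level `n` are joined by edges; within each of the three cells of level
one by induction, and from cell to cell through the midpoints of the sides. -/
lemma reflTransGen_adj (n : ℕ) (k : Fin 3) {x : Plane} (hx : x ∈ vertices a n) :
    Relation.ReflTransGen (Adj a n) (a k) x := by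
  have lift : ∀ (m : ℕ) (i : Fin 3) (y z : Plane), Relation.ReflTransGen (Adj a m) y z →
      Relation.ReflTransGen (Adj a (m + 1)) (contraction (a i) y) (contraction (a i) z) := by
    intro m i y z hyz
    refine hyz.lift _ ?_
    rintro _ _ ⟨w, hw, j, l, hjl, rfl, rfl⟩
    exact ⟨i :: w, by simp [hw], j, l, hjl, rfl, rfl⟩
  induction n generalizing k x with
  | zero =>
    obtain ⟨w, hw, _, ⟨j, rfl⟩, rfl⟩ := hx
    obtain rfl := List.length_eq_zero_iff.1 hw
    by_cases hkj : k = j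
    · subst hkj; exact Relation.ReflTransGen.refl
    · exact Relation.ReflTransGen.single ⟨[], rfl, k, j, hkj, rfl, rfl⟩
  | succ n ih =>
    obtain ⟨w, hw, y, hy, rfl⟩ := hx
    obtain ⟨i, w, rfl⟩ := List.exists_cons_of_length_eq_add_one hw
    have h1 := lift n k _ _ (ih k (corner_mem_vertices n i))
    have h2 := lift n i _ _ (ih k (x := cellMap a w y) ⟨w, by simpa using hw, y, hy, rfl⟩)
    have h3 : contraction (a k) (a i) = contraction (a i) (a k) := by
      simp only [contraction]; module
    rw [contraction_self, h3] at h1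
    exact h1.trans h2

lemma exists_networkCost (n : ℕ) {z : Plane} (hz : z ∈ prefractal a n) :
    ∃ c, NetworkCost a f g n z c := by
  have hv : ∀ x ∈ vertices a n, ∃ c, NetworkCost a f g n x c := fun x hx => by
    induction reflTransGen_adj n 0 hx with
    | refl => exact ⟨_, .corner 0⟩
    | @tail y z hy hyz ih =>
      obtain ⟨c, hc⟩ := ih hyz.left_mem
      have := NetworkCost.step hyz (t := edgeLength n) ⟨(edgeLength_pos n).le, le_rfl⟩ hc
      rw [edgeParam_edgeLength] at this
      exact ⟨_, this⟩
  obtain ⟨x, y, hxy, t, ht, rfl⟩ := mem_prefractal_iff.1 hz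
  obtain ⟨c, hc⟩ := hv x hxy.left_mem
  exact ⟨_, .step hxy ht hc⟩

lemma value_le_networkValue (h : EikonalData a f g) {n : ℕ} {z : Plane}
    (hz : z ∈ prefractal a n) : value a f g z ≤ networkValue a f g n z :=
  le_csInf (exists_networkCost n hz) fun _ hc => hc.value_le h

lemma corner_mem_prefractal (n : ℕ) (i : Fin 3) : a i ∈ prefractal a n :=
  Or.inl (corner_mem_vertices n i)

lemma networkValue_corner (h : EikonalData a f g) (n : ℕ) (i : Fin 3) :
    networkValue a f g n (a i) = g i :=
  le_antisymm (networkValue_le h (.corner i))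
    ((value_corner h i).symm.le.trans (value_le_networkValue h (corner_mem_prefractal n i)))

lemma networkValue_growth (h : EikonalData a f g) {n : ℕ} {x y : Plane} (hxy : Adj a n x y)
    {t : ℝ} (ht : t ∈ Icc 0 (edgeLength n)) :
    networkValue a f g n (edgeParam n x y t) ≤
      networkValue a f g n x + ∫ r in (0 : ℝ)..t, edgeRate f n x y r := by
  rw [← sub_le_iff_le_add]
  exact le_csInf (exists_networkCost n (Or.inl hxy.left_mem)) fun c hc =>
    sub_le_iff_le_add.2 (networkValue_le h (.step hxy ht hc))

lemma networkValue_growth_right (h : EikonalData a f g) {n : ℕ} {x y : Plane}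
    (hxy : Adj a n x y) {t : ℝ} (ht : t ∈ Icc 0 (edgeLength n)) :
    networkValue a f g n (edgeParam n x y t) ≤
      networkValue a f g n y + ∫ r in t..edgeLength n, edgeRate f n x y r := by
  have := networkValue_growth h hxy.symm (t := edgeLength n - t)
    ⟨by linarith [ht.2], by linarith [ht.1]⟩
  rwa [edgeParam_symm, sub_sub_cancel, integral_edgeRate_symm f x y ht] at this

/-- On each edge, the value function is the explicit solution with its end values: a path that
starts inside an edge leaves it through one of the two ends. -/
lemma networkValue_edge (h : EikonalData a f g) {n : ℕ} {x y : Plane} (hxy : Adj a n x y)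
    {t : ℝ} (ht : t ∈ Icc 0 (edgeLength n)) :
    networkValue a f g n (edgeParam n x y t) =
      min (networkValue a f g n x + ∫ r in (0 : ℝ)..t, edgeRate f n x y r)
        (networkValue a f g n y + ∫ r in t..edgeLength n, edgeRate f n x y r) := by
  refine le_antisymm (le_min (networkValue_growth h hxy ht)
    (networkValue_growth_right h hxy ht)) ?_
  rcases ht.1.eq_or_lt with rfl | h0
  · simp
  rcases ht.2.eq_or_lt with rfl | h1
  · simp
  refine le_csInf (exists_networkCost n (edgeParam_mem_prefractal hxy ht)) ?_
  intro c hc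
  generalize hz : edgeParam n x y t = z at hc
  cases hc with
  | corner i =>
    exact absurd (hz ▸ corner_mem_vertices n i) (edgeParam_notMem_vertices h.side hxy ⟨h0, h1⟩)
  | step hxy' ht' hc =>
    rcases edgeParam_injective h.side hxy hxy' ⟨h0, h1⟩ ht' hz with
      ⟨rfl, rfl, rfl⟩ | ⟨rfl, rfl, rfl⟩
    · exact min_le_of_left_le (by gcongr; exact networkValue_le h hc)
    · rw [integral_edgeRate_symm f _ _ ht]
      exact min_le_of_right_le (by gcongr; exact networkValue_le h hc)

/-- From a vertex other than a corner, some edge is optimal. -/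
lemma networkValue_descent (h : EikonalData a f g) {n : ℕ} {x : Plane}
    (hx : x ∈ vertices a n \ corners a) :
    ∃ y, Adj a n x y ∧ networkValue a f g n y +
      ∫ r in (0 : ℝ)..edgeLength n, edgeRate f n x y r ≤ networkValue a f g n x := by
  have hh := edgeLength_pos n
  have key : ∀ c, NetworkCost a f g n x c → ∃ y, Adj a n x y ∧ networkValue a f g n y +
      ∫ r in (0 : ℝ)..edgeLength n, edgeRate f n x y r ≤ c := by
    intro c hc
    induction hc with
    | corner i => exact absurd ⟨i, rfl⟩ hx.2
    | @step x' y' c t hxy ht hc ih =>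
      rcases ht.1.eq_or_lt with rfl | h0
      · simp only [edgeParam_zero, intervalIntegral.integral_same, add_zero] at hx ih ⊢
        exact ih hx
      rcases ht.2.eq_or_lt with rfl | h1
      · rw [edgeParam_edgeLength]
        refine ⟨x', hxy.symm, ?_⟩
        have := integral_edgeRate_symm f x' y' ⟨le_rfl, hh.le⟩
        rw [sub_zero] at this
        rw [this]
        gcongr
        exact networkValue_le h hc
      · exact absurd hx.1 (edgeParam_notMem_vertices h.side hxy ⟨h0, h1⟩)
  have hfin : {y | Adj a n x y}.Finite :=
    (finite_vertices n).subset fun y hy => hy.symm.left_mem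
  obtain ⟨y, hy, hmin⟩ := hfin.exists_minimalFor (fun y => networkValue a f g n y +
    ∫ r in (0 : ℝ)..edgeLength n, edgeRate f n x y r) _ (exists_adj hx.1)
  refine ⟨y, hy, le_csInf (exists_networkCost n (Or.inl hx.1)) fun c hc => ?_⟩
  obtain ⟨y', hy', hle⟩ := key c hc
  rcases le_total (networkValue a f g n y + ∫ r in (0 : ℝ)..edgeLength n, edgeRate f n x y r)
    (networkValue a f g n y' + ∫ r in (0 : ℝ)..edgeLength n, edgeRate f n x y' r) with h1 | h1
  · exact h1.trans hle
  · exact (hmin hy' h1).trans hle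

lemma hasDerivAt_left_branch (h : EikonalData a f g) {n : ℕ} {x y : Plane} (hxy : Adj a n x y)
    (C t : ℝ) :
    HasDerivAt (fun s => C + ∫ r in (0 : ℝ)..s, edgeRate f n x y r) (edgeRate f n x y t) t :=
  (intervalIntegral.integral_hasDerivAt_right (intervalIntegrable_edgeRate h hxy _ _)
    ((continuous_edgeRate h hxy).stronglyMeasurableAtFilter _ _)
    (continuous_edgeRate h hxy).continuousAt).const_add _

lemma hasDerivAt_right_branch (h : EikonalData a f g) {n : ℕ} {x y : Plane} (hxy : Adj a n x y)
    (C t : ℝ) :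
    HasDerivAt (fun s => C + ∫ r in s..edgeLength n, edgeRate f n x y r)
      (-edgeRate f n x y t) t :=
  (intervalIntegral.integral_hasDerivAt_left (intervalIntegrable_edgeRate h hxy _ _)
    ((continuous_edgeRate h hxy).stronglyMeasurableAtFilter _ _)
    (continuous_edgeRate h hxy).continuousAt).const_add _

lemma continuousOn_networkValue (h : EikonalData a f g) (n : ℕ) :
    ContinuousOn (networkValue a f g n) (prefractal a n) := by
  set ι := {q : Plane × Plane // Adj a n q.1 q.2}
  have : Finite ι := ((finite_vertices n).prod (finite_vertices n)).subset
    (fun q (hq : Adj a n q.1 q.2) => ⟨hq.left_mem, hq.symm.left_mem⟩)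
  set E : ι → Set Plane := fun q => edgeParam n q.1.1 q.1.2 '' Icc 0 (edgeLength n)
  have hE : prefractal a n = ⋃ q, E q := by
    ext z
    rw [mem_prefractal_iff, mem_iUnion]
    exact ⟨fun ⟨x, y, hxy, hz⟩ => ⟨⟨(x, y), hxy⟩, hz⟩, fun ⟨⟨(x, y), hxy⟩, hz⟩ => ⟨x, y, hxy, hz⟩⟩
  rw [hE]
  refine (locallyFinite_of_finite E).continuousOn_iUnion
    (fun q => (isCompact_Icc.image (continuous_edgeParam n _ _)).isClosed) ?_
  rintro ⟨⟨x, y⟩, hxy⟩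
  have hA : Continuous fun s =>
      networkValue a f g n x + ∫ r in (0 : ℝ)..s, edgeRate f n x y r :=
    continuous_iff_continuousAt.2 fun s => (hasDerivAt_left_branch h hxy _ s).continuousAt
  have hB : Continuous fun s =>
      networkValue a f g n y + ∫ r in s..edgeLength n, edgeRate f n x y r :=
    continuous_iff_continuousAt.2 fun s => (hasDerivAt_right_branch h hxy _ s).continuousAt
  have hd : Continuous fun z : Plane => dist x z := continuous_const.dist continuous_id
  refine ((hA.min hB).comp hd).continuousOn.congr ?_
  rintro _ ⟨t, ht, rfl⟩
  simp only [Function.comp_apply, dist_left_edgeParam h.side hxy ht.1]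
  exact networkValue_edge h hxy ht

lemma tendsto_edgeParam {n : ℕ} {x y : Plane} (hxy : Adj a n x y) {t : ℝ}
    (ht : t ∈ Ioo 0 (edgeLength n)) :
    Tendsto (edgeParam n x y) (𝓝 t) (𝓝[prefractal a n] (edgeParam n x y t)) :=
  tendsto_nhdsWithin_iff.2 ⟨(continuous_edgeParam n x y).continuousAt,
    mem_of_superset (Icc_mem_nhds ht.1 ht.2) fun _ hs => edgeParam_mem_prefractal hxy hs⟩

lemma tendsto_edgeParam_zero (n : ℕ) {x y : Plane} {Ω : Set Plane} (hΩ : segment ℝ x y ⊆ Ω) :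
    Tendsto (edgeParam n x y) (𝓝[Icc 0 (edgeLength n)] 0) (𝓝[Ω] x) := by
  refine tendsto_nhdsWithin_iff.2 ⟨?_, eventually_nhdsWithin_of_forall fun s hs =>
    hΩ (segment_eq_image_edgeParam n x y ▸ ⟨s, hs, rfl⟩)⟩
  have := (continuous_edgeParam n x y).tendsto 0
  rw [edgeParam_zero] at this
  exact this.mono_left nhdsWithin_le_nhds

/-- A one-sided version of Fermat's rule. -/
lemma le_of_hasDerivWithinAt_of_le {A ψ : ℝ → ℝ} {b d p : ℝ} (hb : 0 < b)
    (hA : HasDerivAt A d 0) (hψ : HasDerivWithinAt ψ p (Icc 0 b) 0)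
    (hle : ∀ᶠ s in 𝓝[Icc 0 b] 0, A s - A 0 ≤ ψ s - ψ 0) : d ≤ p := by
  have hIoi : 𝓝[>] (0 : ℝ) ≤ 𝓝[Icc 0 b] 0 := by
    rw [← nhdsWithin_Ioc_eq_nhdsGT hb]
    exact nhdsWithin_mono _ Ioc_subset_Icc_self
  have h1 := (hψ.mono_of_mem_nhdsWithin (hIoi self_mem_nhdsWithin)).sub
    (hA.hasDerivWithinAt (s := Ioi 0))
  have h2 := (hasDerivWithinAt_iff_tendsto_slope' (self_notMem_Ioi)).1 h1
  have h3 : 0 ≤ p - d := by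
    refine ge_of_tendsto h2 ?_
    filter_upwards [hIoi hle, self_mem_nhdsWithin] with s hs hs0
    rw [slope_def_field]
    refine div_nonneg ?_ (sub_nonneg.2 (le_of_lt hs0))
    simp only [Pi.sub_apply]
    linarith
  linarith

lemma isNetworkSubsolution_networkValue (h : EikonalData a f g) (n : ℕ) :
    IsNetworkSubsolution a f n (networkValue a f g n) where
  usc := (continuousOn_networkValue h n).upperSemicontinuousOn
  edge x y hxy t ht φ p _ hp hmax := by
    have hp' : HasDerivAt (fun s => φ (edgeParam n x y s)) p t :=
      hp.hasDerivAt (Icc_mem_nhds ht.1 ht.2)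
    have hsup := mem_superdiff_of_isLocalMax (w := fun s => networkValue a f g n
      (edgeParam n x y s)) hp' ((tendsto_edgeParam hxy ht).eventually hmax)
    rw [← edgeRate_of_mem f x y (Ioo_subset_Icc_self ht)]
    refine abs_le_of_mem_superdiff hsup fun ε hε => ?_
    -- both branches of the minimum have slope `± f`
    filter_upwards [(hasDerivAt_iff_isLittleO.1 (hasDerivAt_left_branch h hxy
        (networkValue a f g n x) t)).def hε,
      (hasDerivAt_iff_isLittleO.1 (hasDerivAt_right_branch h hxy
        (networkValue a f g n y) t)).def hε, Icc_mem_nhds ht.1 ht.2] with s h1 h2 hs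
    rw [networkValue_edge h hxy hs, networkValue_edge h hxy (Ioo_subset_Icc_self ht)]
    set A := fun s => networkValue a f g n x + ∫ r in (0 : ℝ)..s, edgeRate f n x y r
    set B := fun s => networkValue a f g n y + ∫ r in s..edgeLength n, edgeRate f n x y r
    change ‖A s - A t - (s - t) • _‖ ≤ _ at h1
    change ‖B s - B t - (s - t) • _‖ ≤ _ at h2
    change min (A t) (B t) - _ ≤ min (A s) (B s)
    rw [Real.norm_eq_abs, Real.norm_eq_abs, smul_eq_mul] at h1 h2
    have h3 := neg_abs_le (A s - A t - (s - t) * edgeRate f n x y t)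
    have h4 := neg_abs_le (B s - B t - (s - t) * -edgeRate f n x y t)
    have h5 : |(s - t) * edgeRate f n x y t| = edgeRate f n x y t * |s - t| := by
      rw [abs_mul, abs_of_pos (edgeRate_pos h hxy t), mul_comm]
    have h6 := neg_abs_le ((s - t) * edgeRate f n x y t)
    have h7 := le_abs_self ((s - t) * edgeRate f n x y t)
    refine le_min ?_ ?_
    · linarith [min_le_left (A t) (B t)]
    · linarith [min_le_right (A t) (B t)]
  vertex x hx y z hxy hxz hyz φ p hφ hmax := by
    obtain ⟨-, q, hp, hq, hpq⟩ := hφ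
    have hh := edgeLength_pos n
    -- along any edge from `x`, the value drops at rate at most `f`, and so does the test function
    have key : ∀ y', Adj a n x y' → segment ℝ x y' ⊆ segment ℝ x y ∪ segment ℝ x z →
        ∀ p', HasEdgeDeriv n φ x y' 0 p' → -f x ≤ p' := by
      intro y' hxy' hseg p' hp'
      have hd := hasDerivAt_left_branch h hxy' 0 0
      rw [edgeRate_of_mem f x y' ⟨le_rfl, hh.le⟩, edgeParam_zero] at hd
      refine le_of_hasDerivWithinAt_of_le hh hd.neg hp' ?_
      filter_upwards [(tendsto_edgeParam_zero n hseg).eventually hmax,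
        self_mem_nhdsWithin] with s hs hs'
      have h1 := networkValue_growth_right h hxy' ⟨le_rfl, hh.le⟩
      have h2 := intervalIntegral.integral_add_adjacent_intervals
        (intervalIntegrable_edgeRate h hxy' 0 s)
        (intervalIntegrable_edgeRate h hxy' s (edgeLength n))
      have h3 := integral_edgeRate_nonneg h hxy' hs'.2
      have h4 := integral_edgeRate_nonneg h hxy' hs'.1
      have h5 : networkValue a f g n x - ∫ r in (0 : ℝ)..s, edgeRate f n x y' r ≤
          networkValue a f g n (edgeParam n x y' s) := by
        rw [edgeParam_zero] at h1
        rw [networkValue_edge h hxy' hs']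
        exact le_min (by linarith) (by linarith)
      simp only [Pi.neg_apply, intervalIntegral.integral_same, edgeParam_zero]
      linarith
    have h1 := key y hxy subset_union_left p hp
    have h2 := key z hxz subset_union_right q hq
    rw [abs_le]
    constructor <;> linarith

lemma isNetworkSupersolution_networkValue (h : EikonalData a f g) (n : ℕ) :
    IsNetworkSupersolution a f n (networkValue a f g n) where
  lsc := (continuousOn_networkValue h n).lowerSemicontinuousOn
  edge x y hxy t ht φ p _ hp hmin := by
    have ht' := Ioo_subset_Icc_self ht
    have hp' : HasDerivAt (fun s => φ (edgeParam n x y s)) p t :=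
      hp.hasDerivAt (Icc_mem_nhds ht.1 ht.2)
    have hsub := mem_subdiff_of_isLocalMin (w := fun s => networkValue a f g n
      (edgeParam n x y s)) hp' ((tendsto_edgeParam hxy ht).eventually hmin)
    -- the test function touches the active branch of the minimum as well
    have key : ∀ A : ℝ → ℝ, networkValue a f g n (edgeParam n x y t) = A t →
        (∀ s ∈ Icc 0 (edgeLength n), networkValue a f g n (edgeParam n x y s) ≤ A s) →
        ∀ d, HasDerivAt A d t → p = d := by
      intro A hAt hA d hd
      have hsubA : p ∈ subdiff A t := fun ε hε => by
        filter_upwards [hsub ε hε, Icc_mem_nhds ht.1 ht.2] with s hs hs'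
        rw [← hAt]
        exact hs.trans (hA s hs')
      exact le_antisymm (le_of_mem_subdiff_right hsubA hd.hasDerivWithinAt)
        (le_of_mem_subdiff_left hsubA hd.hasDerivWithinAt)
    rw [← edgeRate_of_mem f x y ht']
    rcases min_choice (networkValue a f g n x + ∫ r in (0 : ℝ)..t, edgeRate f n x y r)
      (networkValue a f g n y + ∫ r in t..edgeLength n, edgeRate f n x y r) with h1 | h1 <;>
      rw [← networkValue_edge h hxy ht'] at h1
    · rw [key _ h1 (fun s hs => networkValue_growth h hxy hs) _ (hasDerivAt_left_branch h hxy _ t)]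
      exact le_abs_self _
    · rw [key _ h1 (fun s hs => networkValue_growth_right h hxy hs) _
        (hasDerivAt_right_branch h hxy _ t), abs_neg]
      exact le_abs_self _
  vertex x hx y hxy := by
    have hh := edgeLength_pos n
    -- an optimal edge is a feasible partner; if it is the given edge, any other one will do
    have key : ∀ y' z, Adj a n x y' → networkValue a f g n y' +
        ∫ r in (0 : ℝ)..edgeLength n, edgeRate f n x y' r ≤ networkValue a f g n x →
        segment ℝ x y' ⊆ segment ℝ x y ∪ segment ℝ x z → ∀ (φ : Plane → ℝ) (p' : ℝ),
        HasEdgeDeriv n φ x y' 0 p' → IsLocalMinOn (fun z' => networkValue a f g n z' - φ z')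
          (segment ℝ x y ∪ segment ℝ x z) x → p' ≤ -f x := by
      intro y' z hxy' hdesc hseg φ p' hp' hmin
      have hd := hasDerivAt_left_branch h hxy' 0 0
      rw [edgeRate_of_mem f x y' ⟨le_rfl, hh.le⟩, edgeParam_zero] at hd
      refine le_neg_of_le_neg (le_of_hasDerivWithinAt_of_le hh hd hp'.neg ?_)
      filter_upwards [(tendsto_edgeParam_zero n hseg).eventually hmin,
        self_mem_nhdsWithin] with s hs hs'
      have h1 := networkValue_growth_right h hxy' hs'
      have h2 := intervalIntegral.integral_add_adjacent_intervals
        (intervalIntegrable_edgeRate h hxy' 0 s)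
        (intervalIntegrable_edgeRate h hxy' s (edgeLength n))
      simp only [Pi.neg_apply, intervalIntegral.integral_same, edgeParam_zero]
      linarith
    obtain ⟨y', hxy', hdesc⟩ := networkValue_descent h hx
    by_cases hyy : y' = y
    · subst hyy
      obtain ⟨z, hxz, hzy⟩ := exists_adj_ne h.side hxy
      refine ⟨z, hxz, hzy, fun φ p hφ hmin => ?_⟩
      obtain ⟨-, q, hp, -, -⟩ := hφ
      have := key y' z hxy' hdesc subset_union_left φ p hp hmin
      linarith [neg_abs_le p]
    · refine ⟨y', hxy', hyy, fun φ p hφ hmin => ?_⟩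
      obtain ⟨-, q, -, hq, hpq⟩ := hφ
      have := key y' y' hxy' hdesc subset_union_right φ q hq hmin
      linarith [le_abs_self p]

lemma isNetworkSolution_networkValue (h : EikonalData a f g) (n : ℕ) :
    IsNetworkSolution a f g n (networkValue a f g n) :=
  ⟨isNetworkSubsolution_networkValue h n, isNetworkSupersolution_networkValue h n,
    networkValue_corner h n⟩

/-! ### Convergence -/

/-- The McShane extension, with Lipschitz constant `K`, of the values of `v` at the corners of
the cell of `w`. -/
def cellExtension (a : Fin 3 → Plane) (v : Plane → ℝ) (K : ℝ) (w : List (Fin 3)) (x : Plane) : ℝ :=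
  Finset.univ.inf' Finset.univ_nonempty
    fun i : Fin 3 => v (cellMap a w (a i)) + K * dist x (cellMap a w (a i))

lemma abs_cellExtension_sub_le (v : Plane → ℝ) {K : ℝ} (hK : 0 ≤ K) (w : List (Fin 3))
    (x y : Plane) : |cellExtension a v K w x - cellExtension a v K w y| ≤ K * dist x y := by
  have key : ∀ x y, cellExtension a v K w x ≤ cellExtension a v K w y + K * dist x y := by
    intro x y
    obtain ⟨i, -, hi⟩ := Finset.exists_mem_eq_inf' Finset.univ_nonempty
      fun i : Fin 3 => v (cellMap a w (a i)) + K * dist y (cellMap a w (a i))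
    have h1 : cellExtension a v K w x ≤ v (cellMap a w (a i)) + K * dist x (cellMap a w (a i)) :=
      Finset.inf'_le _ (Finset.mem_univ i)
    have h2 := mul_le_mul_of_nonneg_left (dist_triangle x y (cellMap a w (a i))) hK
    rw [cellExtension, cellExtension, hi]
    rw [cellExtension] at h1
    linarith
  have h1 := key x y
  have h2 := key y x
  rw [dist_comm y x] at h2
  rw [abs_le]
  constructor <;> linarith

lemma cellExtension_corner {v : Plane → ℝ} {K : ℝ} {w : List (Fin 3)}
    (hv : ∀ i j, v (cellMap a w (a i)) ≤
      v (cellMap a w (a j)) + K * dist (cellMap a w (a i)) (cellMap a w (a j))) (i : Fin 3) :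
    cellExtension a v K w (cellMap a w (a i)) = v (cellMap a w (a i)) := by
  refine le_antisymm ?_ (Finset.le_inf' _ _ fun j _ => hv i j)
  refine (Finset.inf'_le _ (Finset.mem_univ i)).trans ?_
  simp

/-- If `f` oscillates by at most `ε` on the cells of level `n`, the vertex values of a network
solution extend to a function on the gasket that is Lipschitz on each cell with a constant close
to `f`. The extensions on different cells fit together since cells meet in common corners. -/
lemma IsNetworkSolution.exists_extension (h : EikonalData a f g) {n : ℕ} {v : Plane → ℝ}
    (hv : IsNetworkSolution a f g n v) {ε : ℝ} (hε : 0 < ε)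
    (hosc : ∀ w : List (Fin 3), w.length = n → ∀ x ∈ gasket a, ∀ y ∈ gasket a,
      |f (cellMap a w x) - f (cellMap a w y)| ≤ ε) :
    ∃ W : Plane → ℝ, EqOn W v (vertices a n) ∧ ∀ w : List (Fin 3), w.length = n →
      ∀ x ∈ cellMap a w '' gasket a, ∀ y ∈ cellMap a w '' gasket a,
        |W x - W y| ≤ (f y + 2 * ε) * dist x y := by
  set K : List (Fin 3) → ℝ := fun w => f (cellMap a w (a 0)) + ε with hK
  have hKpos : ∀ w, 0 ≤ K w := fun w => by
    have := h.fpos (cellMap_mem_gasket w (corner_mem_gasket (a := a) 0))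
    simp only [hK]; linarith
  have hle : ∀ w : List (Fin 3), w.length = n → ∀ x ∈ gasket a, f (cellMap a w x) ≤ K w :=
    fun w hw x hx => by
      have := hosc w hw x hx (a 0) (corner_mem_gasket 0)
      simp only [hK]; linarith [le_abs_self (f (cellMap a w x) - f (cellMap a w (a 0)))]
  have hge : ∀ w : List (Fin 3), w.length = n → ∀ x ∈ gasket a, K w ≤ f (cellMap a w x) + 2 * ε :=
    fun w hw x hx => by
      have := hosc w hw x hx (a 0) (corner_mem_gasket 0)
      simp only [hK]; linarith [neg_abs_le (f (cellMap a w x) - f (cellMap a w (a 0)))]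
  have hcorner : ∀ w : List (Fin 3), w.length = n → ∀ i,
      cellExtension a v (K w) w (cellMap a w (a i)) = v (cellMap a w (a i)) := by
    intro w hw
    refine cellExtension_corner fun i j => ?_
    by_cases hij : i = j
    · subst hij; simp
    have hadj : Adj a n (cellMap a w (a j)) (cellMap a w (a i)) :=
      ⟨w, hw, j, i, Ne.symm hij, rfl, rfl⟩
    have h1 := hv.growth h hadj (t := edgeLength n) ⟨(edgeLength_pos n).le, le_rfl⟩
    have h2 := intervalIntegral.integral_mono_on (edgeLength_pos n).le
      (intervalIntegrable_edgeRate h hadj 0 (edgeLength n)) (intervalIntegrable_const (c := K w))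
      fun r hr => by
        have hs : r / edgeLength n ∈ Icc (0 : ℝ) 1 :=
          ⟨div_nonneg hr.1 (edgeLength_pos n).le, (div_le_one (edgeLength_pos n)).2 hr.2⟩
        rw [edgeRate_of_mem f _ _ hr, edgeParam_cellMap]
        exact hle w hw _ (side_subset_gasket h.side j i hs)
    rw [edgeParam_edgeLength] at h1
    rw [intervalIntegral.integral_const, smul_eq_mul, sub_zero] at h2
    rw [hadj.symm.dist_eq h.side]
    linarith
  have hcons : ∀ w w' : List (Fin 3), w.length = n → w'.length = n → ∀ x,
      x ∈ cellMap a w '' gasket a → x ∈ cellMap a w' '' gasket a →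
      cellExtension a v (K w) w x = cellExtension a v (K w') w' x := by
    rintro w w' hw hw' x ⟨y, hy, rfl⟩ ⟨y', hy', he⟩
    rcases cells_inter h.side (hw.trans hw'.symm) hy hy' he.symm with hE | ⟨⟨i, hi⟩, ⟨j, hj⟩⟩
    · simp only [cellExtension, hK, hE (corner_mem_gasket _)]
    · rw [hi, hj] at he
      rw [hi, hcorner w hw, ← he, hcorner w' hw']
  choose! W hWl hWm using fun x (hx : x ∈ gasket a) => exists_cell n hx
  have hsub : ∀ (w : List (Fin 3)) (x : Plane), x ∈ cellMap a w '' gasket a → x ∈ gasket a := by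
    rintro w _ ⟨y, hy, rfl⟩
    exact cellMap_mem_gasket w hy
  have hW : ∀ w : List (Fin 3), w.length = n → ∀ x ∈ cellMap a w '' gasket a,
      cellExtension a v (K (W x)) (W x) x = cellExtension a v (K w) w x := fun w hw x hx =>
    hcons _ _ (hWl x (hsub w x hx)) hw x (hWm x (hsub w x hx)) hx
  refine ⟨fun x => cellExtension a v (K (W x)) (W x) x, ?_, fun w hw x hx y hy => ?_⟩
  · rintro _ ⟨w, hw, _, ⟨i, rfl⟩, rfl⟩
    dsimp only
    rw [hW w hw _ ⟨a i, corner_mem_gasket i, rfl⟩, hcorner w hw]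
  · dsimp only
    rw [hW w hw x hx, hW w hw y hy]
    refine (abs_cellExtension_sub_le v (hKpos w) w x y).trans ?_
    gcongr
    obtain ⟨y', hy', rfl⟩ := hy
    exact hge w hw y' hy'

/-- A function that is Lipschitz on each cell with the local constant `f + ε` grows at rate at
most `f + ε` along curves. -/
lemma le_integral_of_lipschitz_cells (h : EikonalData a f g) {n : ℕ} {W : Plane → ℝ} {ε : ℝ}
    (hW : ∀ w : List (Fin 3), w.length = n → ∀ x ∈ cellMap a w '' gasket a,
      ∀ y ∈ cellMap a w '' gasket a, |W x - W y| ≤ (f y + ε) * dist x y) (hε : 0 < ε)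
    {ξ : ℝ → Plane} (hξ : IsLipCurve a ξ) {T : ℝ} (hT : 0 ≤ T) :
    W (ξ 0) ≤ (∫ r in (0 : ℝ)..T, (f (ξ r) + ε)) + W (ξ T) := by
  have hloc : ∀ t, ∀ᶠ s in 𝓝 t, |W (ξ s) - W (ξ t)| ≤ (f (ξ t) + ε) * |s - t| := fun t => by
    have ht : Tendsto ξ (𝓝 t) (𝓝[gasket a] (ξ t)) :=
      tendsto_nhdsWithin_iff.2 ⟨hξ.continuous.tendsto t, Eventually.of_forall hξ.2⟩
    filter_upwards [ht.eventually (eventually_common_cell n (ξ t))] with s ⟨w, hw, h1, h2⟩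
    refine (hW w hw _ h2 _ h1).trans ?_
    have := h.fpos (hξ.2 t)
    gcongr
    exact lipschitzWith_one_iff.1 hξ.1 s t
  have hc : Continuous fun t => W (ξ t) := continuous_iff_continuousAt.2 fun t => by
    refine tendsto_iff_dist_tendsto_zero.2 (squeeze_zero' (Eventually.of_forall fun _ =>
      dist_nonneg) (hloc t) ?_)
    have : Continuous fun s : ℝ => (f (ξ t) + ε) * |s - t| := by fun_prop
    simpa using this.tendsto t
  have := abs_sub_le_integral_of_touching_above (u := fun t => W (ξ t))
    (F := fun t => f (ξ t) + ε) hT hc.continuousOn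
    ((h.continuous_comp hξ).add continuous_const) (fun t ht φ p _ hp hmax => by
      refine abs_le_of_mem_superdiff
        (mem_superdiff_of_isLocalMax hp (hmax.isLocalMax (Icc_mem_nhds ht.1 ht.2)))
        fun ε' hε' => ?_
      filter_upwards [hloc t] with s hs
      nlinarith [neg_abs_le (W (ξ s) - W (ξ t)), abs_nonneg (s - t)])
  linarith [le_abs_self (W (ξ 0) - W (ξ T))]

/-- At the vertices, a network solution exceeds the value function by at most a multiple of the
oscillation of `f` on the cells. -/
lemma IsNetworkSolution.le_value_vertex (h : EikonalData a f g) {n : ℕ} {v : Plane → ℝ}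
    (hv : IsNetworkSolution a f g n v) {ε c m : ℝ} (hε : 0 < ε)
    (hosc : ∀ w : List (Fin 3), w.length = n → ∀ x ∈ gasket a, ∀ y ∈ gasket a,
      |f (cellMap a w x) - f (cellMap a w y)| ≤ ε)
    (hc : 0 < c) (hcf : ∀ x ∈ gasket a, c ≤ f x) (hm : ∀ j, m ≤ g j)
    {x : Plane} (hx : x ∈ vertices a n) :
    v x ≤ value a f g x + 2 * ε / c * (value a f g x - m) := by
  obtain ⟨W, hWv, hW⟩ := hv.exists_extension h hε hosc
  have hk : 0 < 2 * ε / c := by positivity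
  have key : (v x + 2 * ε / c * m) / (1 + 2 * ε / c) ≤ value a f g x := by
    refine le_csInf (costs_nonempty h (vertices_subset_gasket n hx)) ?_
    rintro _ ⟨ξ, T, j, hξ, hT, rfl, hj, rfl⟩
    have h1 := le_integral_of_lipschitz_cells h hW (by positivity) hξ hT
    rw [hWv hx, hj, hWv (corner_mem_vertices n j), hv.boundary] at h1
    have h2 : ∫ r in (0 : ℝ)..T, (f (ξ r) + 2 * ε) ≤
        ∫ r in (0 : ℝ)..T, (1 + 2 * ε / c) * f (ξ r) := by
      refine intervalIntegral.integral_mono_on hT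
        ((h.intervalIntegrable hξ _ _).add intervalIntegrable_const)
        ((h.intervalIntegrable hξ _ _).const_mul _) fun r _ => ?_
      have h3 : 2 * ε / c * c ≤ 2 * ε / c * f (ξ r) := by gcongr; exact hcf _ (hξ.2 r)
      rw [div_mul_cancel₀ _ hc.ne'] at h3
      linarith
    rw [intervalIntegral.integral_const_mul] at h2
    have h4 : 2 * ε / c * m ≤ 2 * ε / c * g j := by gcongr; exact hm j
    rw [div_le_iff₀ (by positivity)]
    linarith
  rw [div_le_iff₀ (by positivity)] at key
  linarith

lemma exists_oscillation_le (h : EikonalData a f g) {ε : ℝ} (hε : 0 < ε) :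
    ∃ N, ∀ n ≥ N, ∀ w : List (Fin 3), w.length = n → ∀ x ∈ gasket a, ∀ y ∈ gasket a,
      |f (cellMap a w x) - f (cellMap a w y)| ≤ ε := by
  obtain ⟨δ, hδ, hf⟩ := Metric.uniformContinuousOn_iff.1
    (isCompact_gasket.uniformContinuousOn_of_continuous h.cont) ε hε
  obtain ⟨N, hN⟩ := exists_edgeLength_lt hδ
  refine ⟨N, fun n hn w hw x hx y hy => ?_⟩
  refine (hf _ (cellMap_mem_gasket w hx) _ (cellMap_mem_gasket w hy) ?_).le
  refine lt_of_le_of_lt ?_ (hN n hn)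
  rw [dist_cellMap, hw, edgeLength]
  gcongr
  exact dist_le_one_of_mem_gasket h.side hx hy

lemma tendsto_networkSolution (h : EikonalData a f g) {ε : ℝ} (hε : 0 < ε) :
    ∃ N, ∀ n ≥ N, ∀ v, IsNetworkSolution a f g n v →
      ∀ x ∈ prefractal a n, |v x - value a f g x| < ε := by
  obtain ⟨c, hc, hcf⟩ := h.pos
  obtain ⟨M, hM0, hM⟩ := h.exists_bound
  obtain ⟨m, hm⟩ := exists_le_boundary g
  obtain ⟨B, hB⟩ := isCompact_gasket.exists_bound_of_continuousOn (continuousOn_value h)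
  set D : ℝ := |B - m| + 1 with hD
  have hD0 : 0 < D := by positivity
  obtain ⟨N₁, hN₁⟩ := exists_oscillation_le h (show 0 < ε * c / (4 * D) by positivity)
  obtain ⟨N₂, hN₂⟩ := exists_edgeLength_lt (show 0 < ε / (8 * M) by positivity)
  refine ⟨max N₁ N₂, fun n hn v hv z hz => ?_⟩
  have hlow := hv.le_of_growth h (fun _ _ hxy _ ht => value_growth h hxy ht)
    (fun i => (value_corner h i).le) z hz
  obtain ⟨x, y, hxy, t, ht, rfl⟩ := mem_prefractal_iff.1 hz
  have h1 := hv.le_value_vertex h (by positivity) (hN₁ n ((le_max_left _ _).trans hn)) hc hcf hm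
    hxy.left_mem
  have hh := hN₂ n ((le_max_right _ _).trans hn)
  rw [lt_div_iff₀ (by positivity)] at hh
  have h2 : 2 * (ε * c / (4 * D)) / c * (value a f g x - m) ≤ ε / 2 := by
    have h3 : value a f g x - m ≤ D := by
      have := hB x (vertices_subset_gasket n hxy.left_mem)
      rw [Real.norm_eq_abs] at this
      linarith [le_abs_self (value a f g x), le_abs_self (B - m)]
    calc 2 * (ε * c / (4 * D)) / c * (value a f g x - m)
        ≤ 2 * (ε * c / (4 * D)) / c * D := by gcongr
      _ = ε / 2 := by field_simp; norm_num
  have h4 : v (edgeParam n x y t) ≤ v x + M * edgeLength n := by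
    have h5 := hv.growth h hxy ht
    have h6 := intervalIntegral.integral_mono_on ht.1 (intervalIntegrable_edgeRate h hxy 0 t)
      (intervalIntegrable_const (c := M)) fun r hr =>
        hM _ (edgeParam_mem_gasket h.side hxy (projIcc _ _ (edgeLength_pos n).le r).2)
    rw [intervalIntegral.integral_const, smul_eq_mul, sub_zero] at h6
    have h7 : t * M ≤ edgeLength n * M := by gcongr; exact ht.2
    linarith
  have h8 : |value a f g x - value a f g (edgeParam n x y t)| ≤ M * (3 * edgeLength n) := by
    obtain ⟨w, hw, i, j, -, rfl, rfl⟩ := hxy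
    rw [← hw, edgeParam_cellMap]
    refine abs_value_sub_le_of_cell h hM ⟨a i, corner_mem_gasket i, rfl⟩
      ⟨_, side_subset_gasket h.side i j ?_, rfl⟩
    rw [hw]
    exact ⟨div_nonneg ht.1 (edgeLength_pos n).le, (div_le_one (edgeLength_pos n)).2 ht.2⟩
  rw [abs_of_nonneg (sub_nonneg.2 hlow)]
  linarith [le_abs_self (value a f g x - value a f g (edgeParam n x y t))]

end SierpinskiEikonal

end

theorem mainTheorem1
    (a : Fin 3 → SierpinskiEikonal.Plane) (ha : ∀ i j, i ≠ j → dist (a i) (a j) = 1)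
    (f : SierpinskiEikonal.Plane → ℝ) (hf : ContinuousOn f (SierpinskiEikonal.gasket a))
    (hpos : ∃ c > 0, ∀ x ∈ SierpinskiEikonal.gasket a, c ≤ f x)
    (g : Fin 3 → ℝ) (hg : SierpinskiEikonal.Compatible a f g) :
    (∀ n, ∃ v, SierpinskiEikonal.IsNetworkSolution a f g n v ∧
      ∀ v', SierpinskiEikonal.IsNetworkSolution a f g n v' →
        EqOn v' v (SierpinskiEikonal.prefractal a n)) ∧
    ∃ u, SierpinskiEikonal.IsMetricSolution a f g u ∧
      (∀ u', SierpinskiEikonal.IsMetricSolution a f g u' →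
        EqOn u' u (SierpinskiEikonal.gasket a)) ∧
      ContinuousOn u (SierpinskiEikonal.gasket a) ∧
      ∀ U : ℕ → SierpinskiEikonal.Plane → ℝ,
        (∀ n, SierpinskiEikonal.IsNetworkSolution a f g n (U n)) →
        ∀ ε > 0, ∃ N, ∀ n ≥ N, ∀ x ∈ SierpinskiEikonal.prefractal a n, |U n x - u x| < ε := by
  have h : SierpinskiEikonal.EikonalData a f g := ⟨ha, hf, hpos, hg⟩
  refine ⟨fun n => ⟨_, SierpinskiEikonal.isNetworkSolution_networkValue h n,
    fun v' hv' => (SierpinskiEikonal.isNetworkSolution_networkValue h n).eqOn h hv'⟩,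
    SierpinskiEikonal.value a f g, SierpinskiEikonal.isMetricSolution_value h,
    fun u' hu' x hx => le_antisymm (hu'.le_value h hx) (hu'.value_le h hx),
    SierpinskiEikonal.continuousOn_value h, fun U hU ε hε => ?_⟩
  obtain ⟨N, hN⟩ := SierpinskiEikonal.tendsto_networkSolution h hε
  exact ⟨N, fun n hn => hN n hn (U n) (hU n)⟩
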